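/- A planar tree is a rooted, locally finite tree $T$ whose vertices at height (distance from the root) $r$ form a finite ordered set $D_r=D_r(T)$, with order-preserving parent maps $D_r\to D_{r-1}$, and such that $|D_0|=|D_1|=1$; isomorphic planar trees are identified. Its size $|T|$ is its number of edges, its height $h(T)$ (for finite $T$) is the largest $r$ with $D_r\neq\emptyset$, and for $r\ge 1$ the ball $B_r(T)$ is the subtree spanned by the vertices of height at most $r$, so that $|B_r(T)|=\sum_{s=1}^r|D_s(T)|$. The set $\mathcal T$ of all finite and infinite planar trees carries the metric $\mathrm{dist}(T,T')=\inf\{1/r \mid r\ge 1,\ B_r(T)=B_r(T')\}$ and its Borel $\sigma$-algebra. For $\mu\in\mathbb R$ and $N\ge 1$ let $\nu_N^{(\mu)}$ be the probability measure on $\mathcal T$ supported on the trees of size $N$ with $\nu_N^{(\mu)}(\{T\})=e^{-\mu h(T)}/Z_N^{(\mu)}$, where $Z_N^{(\mu)}=\sum_{|T|=N}e^{-\mu h(T)}$. Let $\mu<0$. Then $\nu^{(\mu)}_N$ converges weakly, as $N\to\infty$, to a Borel probability measure $\nu^{(\mu)}$ on $\mathcal T$ (the local limit), and the following holds. There are constants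 $C_1,C_2>0$ (depending only on $\mu$) and for $\nu^{(\mu)}$-a.e. tree $T$ a number $r_0(T)\in\mathbb N$ such that $$1\le |D_r(T)|\le C_1\ln r\qquad\text{and}\qquad r\le |B_r(T)|\le C_2\, r\ln r\qquad\text{for all } r\ge r_0(T).$$ Consequently the limit $d_h=\lim_{r\to\infty}\frac{\ln|B_r(T)|}{\ln r}$ exists and equals $1$ for $\nu^{(\mu)}$-a.e. tree $T$. -/

import Mathlib

open Filter Topology MeasureTheory
open scoped ENNReal BoundedContinuousFunction

/-- A (rooted, locally finite) planar tree whose root has exactly one offspring.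
The vertices at height `r` form a finite ordered set `D r`, which is represented by its canonical
copy `{0, …, |D r| - 1}` (left to right), so that two trees are isomorphic as planar trees if and
only if they are equal.  The list `parents r` is the order preserving parent map
`D (r + 1) → D r`: its `i`-th entry is the position in `D r` of the parent of the `i`-th vertex of
`D (r + 1)`.  In particular `D (r + 1)` has `(parents r).length` elements, and `D 0`, `D 1` are
one-point sets. -/
@[ext]
structure PlanarTree where
  parents : ℕ → List ℕ
  parents_zero : parents 0 = [0]
  parents_mono : ∀ r, (parents r).Pairwise (· ≤ ·)
  parents_lt : ∀ r, ∀ p ∈ parents (r + 1), p < (parents r).length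

namespace PlanarTree

/-- The number `|D_r(T)|` of vertices at height `r`. -/
def width (T : PlanarTree) : ℕ → ℕ
  | 0 => 1
  | r + 1 => (T.parents r).length

/-- The edges of `T`: the pair `(s, i)` stands for the edge which joins the `i`-th vertex at height
`s + 1` to its parent. -/
def edges (T : PlanarTree) : Set (ℕ × ℕ) := {e | e.2 < T.width (e.1 + 1)}

/-- The size `|T|`, i.e. the number of edges, possibly infinite. -/
noncomputable def size (T : PlanarTree) : ℕ∞ := T.edges.encard

/-- The height of a finite tree: the largest `r` for which there is a vertex at height `r`.
(It is used for finite trees only.) -/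
noncomputable def height (T : PlanarTree) : ℕ := sSup {r | T.width r ≠ 0}

/-- The ball `B_r(T)`, `r ≥ 1`: the subtree of `T` spanned by the vertices of height at most `r`.
(Trees have at least one edge; for `r = 0` this is `B_1(T)`.) -/
def ball (T : PlanarTree) (r : ℕ) : PlanarTree where
  parents s := if s < r ∨ s = 0 then T.parents s else []
  parents_zero := by simp [T.parents_zero]
  parents_mono s := by
    split_ifs
    · exact T.parents_mono s
    · exact List.Pairwise.nil
  parents_lt s p hp := by
    by_cases h : s + 1 < r
    · have h' : s < r := by omega
      simp only [h, h', true_or, if_true] at hp ⊢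
      exact T.parents_lt s p hp
    · simp [h] at hp

/-- The volume `|B_r(T)|`, i.e. the number of edges of the (finite) tree `B_r(T)`. -/
noncomputable def ballVolume (T : PlanarTree) (r : ℕ) : ℕ := (T.ball r).edges.ncard

theorem ball_eq_iff {T T' : PlanarTree} {r : ℕ} :
    T.ball r = T'.ball r ↔ ∀ s < r, T.parents s = T'.parents s := by
  constructor
  · intro h s hs
    have := congrFun (congrArg PlanarTree.parents h) s
    simpa [ball, hs] using this
  · intro h
    ext1
    funext s
    by_cases hs : s < r
    · simp [ball, hs, h s hs]
    · rcases Nat.eq_zero_or_pos s with rfl | h0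
      · simp [ball, T.parents_zero, T'.parents_zero]
      · have : s ≠ 0 := by omega
        simp [ball, hs, this]

/-- The numbers `1 / r`, `r ≥ 1`, for which `B_r(T) = B_r(T')`. -/
def agreement (T T' : PlanarTree) : Set ℝ :=
  {x | ∃ r : ℕ, 1 ≤ r ∧ T.ball r = T'.ball r ∧ x = 1 / (r : ℝ)}

/-- `dist(T, T') = inf {1 / r | r ≥ 1, B_r(T) = B_r(T')}`. -/
noncomputable instance : Dist PlanarTree := ⟨fun T T' => sInf (agreement T T')⟩

theorem dist_def (T T' : PlanarTree) : dist T T' = sInf (agreement T T') := rfl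

theorem agreement_nonempty (T T' : PlanarTree) : (agreement T T').Nonempty := by
  refine ⟨1, 1, le_rfl, ball_eq_iff.2 ?_, by simp⟩
  intro s hs
  obtain rfl : s = 0 := by omega
  rw [T.parents_zero, T'.parents_zero]

theorem agreement_nonneg (T T' : PlanarTree) : ∀ x ∈ agreement T T', 0 ≤ x := by
  rintro x ⟨r, -, -, rfl⟩
  positivity

theorem agreement_bddBelow (T T' : PlanarTree) : BddBelow (agreement T T') :=
  ⟨0, fun x hx => agreement_nonneg T T' x hx⟩

theorem exists_of_dist_lt {T T' : PlanarTree} {a : ℝ} (h : dist T T' < a) :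
    ∃ r : ℕ, 1 ≤ r ∧ 1 / (r : ℝ) < a ∧ T.ball r = T'.ball r := by
  obtain ⟨x, ⟨r, hr, hb, rfl⟩, hx⟩ := exists_lt_of_csInf_lt (agreement_nonempty T T') h
  exact ⟨r, hr, hx, hb⟩

theorem dist_le_of_ball_eq {T T' : PlanarTree} {r : ℕ} (hr : 1 ≤ r) (h : T.ball r = T'.ball r) :
    dist T T' ≤ 1 / (r : ℝ) :=
  csInf_le (agreement_bddBelow T T') ⟨r, hr, h, rfl⟩

theorem dist_nonneg' (T T' : PlanarTree) : 0 ≤ dist T T' :=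
  le_csInf (agreement_nonempty T T') (agreement_nonneg T T')

noncomputable instance : MetricSpace PlanarTree where
  dist_self T := by
    refine le_antisymm (le_of_forall_pos_le_add fun ε hε => ?_) (dist_nonneg' T T)
    obtain ⟨n, hn⟩ := exists_nat_one_div_lt hε
    have := dist_le_of_ball_eq (T := T) (T' := T) (r := n + 1) (by omega) rfl
    push_cast at this
    linarith
  dist_comm T T' := by
    simp only [dist_def, agreement, eq_comm]
  dist_triangle T₁ T₂ T₃ := by
    refine le_of_forall_pos_le_add fun ε hε => ?_
    obtain ⟨r, hr, hra, hrb⟩ := exists_of_dist_lt (lt_add_of_pos_right (dist T₁ T₂) hε)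
    obtain ⟨s, hs, hsa, hsb⟩ := exists_of_dist_lt (lt_add_of_pos_right (dist T₂ T₃) hε)
    have h12 := dist_nonneg' T₁ T₂
    have h23 := dist_nonneg' T₂ T₃
    rw [ball_eq_iff] at hrb hsb
    rcases le_total r s with h | h
    · have := dist_le_of_ball_eq (T := T₁) (T' := T₃) hr (ball_eq_iff.2 fun i hi =>
        (hrb i hi).trans (hsb i (by omega)))
      linarith
    · have := dist_le_of_ball_eq (T := T₁) (T' := T₃) hs (ball_eq_iff.2 fun i hi =>
        (hrb i (by omega)).trans (hsb i hi))
      linarith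
  eq_of_dist_eq_zero := by
    intro T T' h
    ext1
    funext s
    have hpos : dist T T' < 1 / ((s : ℝ) + 1) := by
      have : dist T T' = 0 := h
      rw [this]
      positivity
    obtain ⟨r, hr, hrs, hb⟩ := exists_of_dist_lt hpos
    have hr0 : (0 : ℝ) < r := by exact_mod_cast hr
    have hlt : (s : ℝ) + 1 < r := (one_div_lt_one_div hr0 (by positivity)).1 hrs
    have hlt' : s + 1 < r := by exact_mod_cast hlt
    exact ball_eq_iff.1 hb s (by omega)

noncomputable instance : MeasurableSpace PlanarTree := borel PlanarTree

instance : BorelSpace PlanarTree := ⟨rfl⟩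

/-- The set of planar trees with exactly `N` edges. -/
def treesOfSize (N : ℕ) : Set PlanarTree := {T | T.size = N}

/-- The weight `exp (-μ h(T))` of a finite tree. -/
noncomputable def weight (μ : ℝ) (T : PlanarTree) : ℝ≥0∞ :=
  ENNReal.ofReal (Real.exp (-μ * T.height))

/-- The finite size partition function: the sum of `exp (-μ h(T))` over all trees `T` of
size `N`. -/
noncomputable def partitionFunction (μ : ℝ) (N : ℕ) : ℝ≥0∞ :=
  ∑' T : treesOfSize N, weight μ T

/-- The probability measure on trees of size `N ≥ 1` that gives mass `exp (-μ h(T)) / Z_N` to each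
tree `T` of size `N`, as a Borel measure on the space of all trees. -/
noncomputable def finiteSizeMeasure (μ : ℝ) (N : ℕ) : Measure PlanarTree :=
  Measure.sum fun T : treesOfSize N => (weight μ T / partitionFunction μ N) • Measure.dirac T.1

/-- `ν` is the local limit of the finite size measures: a Borel probability measure to which they
converge weakly as `N → ∞`. -/
def IsLocalLimit (μ : ℝ) (ν : Measure PlanarTree) : Prop :=
  IsProbabilityMeasure ν ∧
    ∀ F : PlanarTree →ᵇ ℝ,
      Tendsto (fun N : ℕ => ∫ T, F T ∂(finiteSizeMeasure μ N)) atTop (𝓝 (∫ T, F T ∂ν))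

/-- The tree `T` has volume growth exponent (Hausdorff dimension) `d`: the limit of
`ln |B_r(T)| / ln r` as `r → ∞` exists and equals `d`. -/
def HasHausdorffDim (T : PlanarTree) (d : ℝ) : Prop :=
  Tendsto (fun r : ℕ => Real.log (T.ballVolume r) / Real.log r) atTop (𝓝 d)

end PlanarTree

/-!
In the variable `l` with `koebe l = x`, the generating function of the planar trees of height at
most `m`, counted by `x ^ size`, is a rational function of `l`. Put `b = exp μ < 1`. Weighting the
height by `b⁻¹` per level and summing over `m`, the leading term in `l ^ m` gives a geometric series
of ratio `l / b`, hence a simple pole at `l = b`, while the remainder is holomorphic in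
`|l| ^ 2 < b`. The residue depends on the number `K` of vertices at the top level of the ball that
is extended to a tree of size `N` only through the factor `K * (1 + b) ^ K`. Consequently the
probabilities of cylinders converge, and the limit is the law of a tree whose widths form a Markov
chain, the Doob transform by `K * (1 + b) ^ (K - 1)`.

This chain never reaches `0`, which gives the lower bounds. The weights `K * b ^ (K - 1)` are
invariant for it and dominate its initial law, the point mass at `1`; hence they dominate the law of
the width at every height. This is an exponential tail bound uniform in the height, and the upper
bounds follow by the Borel–Cantelli lemma.
-/

/-! ### Power series -/

theorem tsum_sum_antidiagonal {A : Type*} [AddMonoid A] [Finset.HasAntidiagonal A]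
    (F : A → A → ℝ≥0∞) :
    ∑' n, ∑ p ∈ Finset.HasAntidiagonal.antidiagonal n, F p.1 p.2 = ∑' i, ∑' j, F i j := by
  rw [← ENNReal.tsum_prod, ← Finset.HasAntidiagonal.sigmaAntidiagonalEquivProd.tsum_eq,
    ENNReal.tsum_sigma']
  refine tsum_congr fun n => ?_
  rw [tsum_fintype, ← Finset.sum_attach]
  rfl

theorem hasSum_multichoose_mul_pow {𝕜 : Type*} [NormedField 𝕜] [HasSummableGeomSeries 𝕜] (K : ℕ)
    {z : 𝕜} (hz : ‖z‖ < 1) :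
    HasSum (fun L => (K.multichoose L : 𝕜) * z ^ L) ((1 - z)⁻¹ ^ K) := by
  cases K with
  | zero =>
    have h := hasSum_single (f := fun L => (Nat.multichoose 0 L : 𝕜) * z ^ L) 0 fun L hL => by
      obtain ⟨L, rfl⟩ := Nat.exists_eq_succ_of_ne_zero hL
      simp
    simpa using h
  | succ K =>
    have h := hasSum_choose_mul_geometric_of_norm_lt_one K hz
    rw [one_div, ← inv_pow] at h
    convert! h using 4 with L
    rw [Nat.multichoose_eq, show K + 1 + L - 1 = L + K by omega, ← Nat.choose_symm_add]

section PowerSeries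

open Metric FormalMultilinearSeries

variable {c : ℕ → ℂ} {H : ℂ → ℂ} {R ε : ℝ}

theorem radius_ofScalars_pos_of_summable {x : ℝ} (hx : 0 < x)
    (hc : Summable fun n => c n * (x : ℂ) ^ n) : 0 < (ofScalars ℂ c).radius := by
  refine (ENNReal.coe_pos.2 (Real.toNNReal_pos.2 hx)).trans_le
    (le_radius_of_summable_norm _ (hc.norm.congr fun n => ?_))
  rw [ofScalars_norm, norm_mul, norm_pow, Complex.norm_of_nonneg hx.le, Real.coe_toNNReal x hx.le]

theorem hasSum_of_differentiableOn_ball (hε : 0 < ε) (hH : DifferentiableOn ℂ H (ball 0 R))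
    (hc : ∀ x : ℝ, 0 < x → x < ε → HasSum (fun n => c n * (x : ℂ) ^ n) (H x))
    {z : ℂ} (hz : ‖z‖ < R) : HasSum (fun n => c n * z ^ n) (H z) := by
  obtain ⟨R', hzR', hR'R⟩ := exists_between hz
  have hR' : 0 < R' := (norm_nonneg z).trans_lt hzR'
  lift R' to NNReal using hR'.le
  have hF := (hH.mono (closedBall_subset_ball hR'R)).hasFPowerSeriesOnBall (mod_cast hR')
  have hG := (ofScalars ℂ c).hasFPowerSeriesOnBall <| radius_ofScalars_pos_of_summable (half_pos hε)
    (hc _ (half_pos hε) (half_lt_self hε)).summable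
  have hreal : Tendsto (fun x : ℝ => (x : ℂ)) (𝓝[>] 0) (𝓝[≠] 0) :=
    tendsto_nhdsWithin_iff.2
      ⟨(Complex.continuous_ofReal.tendsto' 0 0 rfl).mono_left nhdsWithin_le_nhds,
        eventually_nhdsWithin_of_forall fun x hx => by simpa using (ne_of_gt hx : x ≠ 0)⟩
  have hfreq : ∃ᶠ z in 𝓝[≠] (0 : ℂ), (ofScalars ℂ c).sum z = H z := by
    refine hreal.frequently (Eventually.frequently ?_)
    filter_upwards [Ioo_mem_nhdsGT hε] with x hx
    rw [← (hc x hx.1 hx.2).tsum_eq]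
    refine tsum_congr fun n => ?_
    rw [apply_eq_pow_smul_coeff, coeff_ofScalars, smul_eq_mul, mul_comm]
  have heq := (hG.analyticAt.frequently_eq_iff_eventually_eq hF.analyticAt).1 hfreq
  have hseries := (hG.hasFPowerSeriesAt.congr heq).eq_formalMultilinearSeries hF.hasFPowerSeriesAt
  have hsum := hF.hasSum (y := z) (by simpa [enorm_eq_nnnorm, ← NNReal.coe_lt_coe] using hzR')
  simpa only [← hseries, zero_add, apply_eq_pow_smul_coeff, coeff_ofScalars, smul_eq_mul,
    mul_comm] using hsum

/-- Multiplying by `g - z` removes the pole, and the partial sums of the resulting series telescope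
at `z = g`. -/
theorem tendsto_coeff_of_simple_pole {g : ℂ} (hε : 0 < ε) (hg : ‖g‖ < R)
    (hH : DifferentiableOn ℂ H (ball 0 R))
    (hc : ∀ x : ℝ, 0 < x → x < ε → ∃ s, HasSum (fun n => c n * (x : ℂ) ^ n) s ∧ (g - x) * s = H x) :
    Tendsto (fun n => c n * g ^ (n + 1)) atTop (𝓝 (H g)) := by
  let q : ℕ → ℂ
    | 0 => g * c 0
    | n + 1 => g * c (n + 1) - c n
  have hq : ∀ x : ℝ, 0 < x → x < ε → HasSum (fun n => q n * (x : ℂ) ^ n) (H x) := by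
    intro x h0 h1
    obtain ⟨s, hs, hHs⟩ := hc x h0 h1
    rw [← hHs, ← hasSum_nat_add_iff' 1]
    have hshift := (hasSum_nat_add_iff' 1).2 hs
    convert ((hshift.mul_left g).sub (hs.mul_left (x : ℂ))) using 1
    · funext n
      simp only [q]
      ring
    · simp only [q, Finset.sum_range_one, pow_zero]
      ring
  have hsum := hasSum_of_differentiableOn_ball hε hH hq hg
  refine (hsum.tendsto_sum_nat.comp (tendsto_add_atTop_nat 1)).congr fun n => ?_
  simp only [Function.comp_def]
  induction n with
  | zero => simp [q]; ring
  | succ n ih =>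
    rw [Finset.sum_range_succ, ih]
    simp only [q]
    ring

end PowerSeries

/-! ### The Koebe function -/

/-- The Koebe function, rotated so that its pole is at `-1`. It maps the unit disc conformally onto
the plane slit along `[1 / 4, ∞)`, and serves as the change of variable that makes the generating
functions of trees of bounded height rational. -/
def koebe {𝕜 : Type*} [Field 𝕜] (z : 𝕜) : 𝕜 := z / (1 + z) ^ 2

section Koebe

open Metric

theorem koebe_sub_koebe {𝕜 : Type*} [Field 𝕜] {z w : 𝕜} (hz : 1 + z ≠ 0) (hw : 1 + w ≠ 0) :
    koebe z - koebe w = (z - w) * (1 - z * w) / ((1 + z) ^ 2 * (1 + w) ^ 2) := by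
  rw [koebe, koebe]
  field_simp
  ring

@[norm_cast]
theorem ofReal_koebe (x : ℝ) : ((koebe x : ℝ) : ℂ) = koebe (x : ℂ) := by
  simp only [koebe]
  push_cast
  rfl

theorem koebe_pos {x : ℝ} (hx : 0 < x) : 0 < koebe x := by
  unfold koebe
  positivity

theorem koebe_strictMonoOn : StrictMonoOn (koebe : ℝ → ℝ) (Set.Icc 0 1) := by
  intro x hx y hy hxy
  have hx0 : 0 < 1 + x := by linarith [hx.1]
  have hy0 : 0 < 1 + y := by linarith [hy.1]
  rw [← sub_pos, koebe_sub_koebe hy0.ne' hx0.ne']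
  have : y * x < 1 := by nlinarith [hx.1, hy.2]
  exact div_pos (mul_pos (sub_pos.2 hxy) (sub_pos.2 this)) (by positivity)

theorem koebe_le_quarter {x : ℝ} (h0 : 0 ≤ x) (h1 : x ≤ 1) : koebe x ≤ 1 / 4 :=
  (koebe_strictMonoOn.monotoneOn ⟨h0, h1⟩ ⟨zero_le_one, le_rfl⟩ h1).trans_eq
    (by norm_num [koebe])

theorem exists_koebe_eq {x b : ℝ} (hb : 0 ≤ b) (hx : 0 < x) (hxb : x < koebe b) :
    ∃ l, 0 < l ∧ l < b ∧ koebe l = x := by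
  have hcont : ContinuousOn (koebe : ℝ → ℝ) (Set.Icc 0 b) :=
    ContinuousOn.div (by fun_prop) (by fun_prop) fun l hl => by have := hl.1; positivity
  obtain ⟨l, hl, rfl⟩ := intermediate_value_Ioo hb hcont ⟨by simpa [koebe] using hx, hxb⟩
  exact ⟨l, hl.1, hl.2, rfl⟩

theorem one_add_ne_zero_of_norm_lt_one {z : ℂ} (hz : ‖z‖ < 1) : 1 + z ≠ 0 := by
  intro h
  rw [← neg_eq_of_add_eq_zero_right h, norm_neg, norm_one] at hz
  exact hz.false

theorem koebe_injOn : Set.InjOn (koebe : ℂ → ℂ) (ball 0 1) := by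
  intro z hz w hw h
  rw [mem_ball_zero_iff] at hz hw
  have hz1 := one_add_ne_zero_of_norm_lt_one hz
  have hw1 := one_add_ne_zero_of_norm_lt_one hw
  have hzw : 1 - z * w ≠ 0 := by
    refine sub_ne_zero.2 fun h1 => ?_
    have : ‖z * w‖ < 1 := by
      rw [norm_mul]
      exact mul_lt_one_of_nonneg_of_lt_one_left (norm_nonneg z) hz hw.le
    simp [← h1] at this
  rw [← sub_eq_zero, koebe_sub_koebe hz1 hw1] at h
  simpa [hzw, hz1, hw1, sub_eq_zero] using h

theorem koebe_norm_le {z : ℂ} (hz : ‖z‖ < 1) : koebe ‖z‖ ≤ ‖koebe z‖ := by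
  have h1 : ‖1 + z‖ ≤ 1 + ‖z‖ := (norm_add_le _ _).trans_eq (by rw [norm_one])
  have h2 : 0 < ‖1 + z‖ := norm_pos_iff.2 (one_add_ne_zero_of_norm_lt_one hz)
  rw [koebe, koebe, norm_div, norm_pow]
  gcongr

/-- The inverse of `koebe` on the disc of radius `1 / 4`. -/
noncomputable def koebeInv (z : ℂ) : ℂ :=
  (1 - (1 - 4 * z) ^ (1 / 2 : ℂ)) / (1 + (1 - 4 * z) ^ (1 / 2 : ℂ))

theorem re_cpow_half_pos {w : ℂ} (hw : 0 < w.re) : 0 < (w ^ (1 / 2 : ℂ)).re := by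
  have hw0 : w ≠ 0 := by rintro rfl; simp at hw
  have him : (Complex.log w * (1 / 2)).im = w.arg / 2 := by
    simp [Complex.mul_im, Complex.log_im, div_eq_mul_inv]
  have harg := abs_lt.1 (Complex.abs_arg_lt_pi_div_two_iff.2 (Or.inl hw))
  rw [Complex.cpow_def_of_ne_zero hw0, Complex.exp_re, him]
  refine mul_pos (Real.exp_pos _) (Real.cos_pos_of_mem_Ioo ⟨?_, ?_⟩) <;>
    linarith [harg.1, harg.2, Real.pi_pos]

theorem re_one_sub_pos {z : ℂ} (hz : ‖z‖ < 1 / 4) : 0 < (1 - 4 * z).re := by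
  have h1 := Complex.re_le_norm z
  have : (1 - 4 * z).re = 1 - 4 * z.re := by simp
  linarith

theorem one_add_ne_zero_of_re_pos {w : ℂ} (hw : 0 < w.re) : 1 + w ≠ 0 := by
  intro h
  have := congrArg Complex.re h
  simp only [Complex.add_re, Complex.one_re, Complex.zero_re] at this
  linarith

theorem norm_koebeInv_lt_one {z : ℂ} (hz : ‖z‖ < 1 / 4) : ‖koebeInv z‖ < 1 := by
  have h := re_cpow_half_pos (re_one_sub_pos hz)
  rw [koebeInv, norm_div, div_lt_one (norm_pos_iff.2 (one_add_ne_zero_of_re_pos h)),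
    ← sq_lt_sq₀ (norm_nonneg _) (norm_nonneg _), Complex.sq_norm, Complex.sq_norm,
    Complex.normSq_apply, Complex.normSq_apply]
  simp only [Complex.sub_re, Complex.one_re, Complex.sub_im, Complex.one_im, Complex.add_re,
    Complex.add_im]
  nlinarith

theorem koebe_koebeInv {z : ℂ} (hz : ‖z‖ < 1 / 4) : koebe (koebeInv z) = z := by
  have hsq : ((1 - 4 * z) ^ (1 / 2 : ℂ)) ^ 2 = 1 - 4 * z := by
    rw [one_div]
    exact_mod_cast Complex.cpow_nat_inv_pow (1 - 4 * z) two_ne_zero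
  have h1 := one_add_ne_zero_of_re_pos (re_cpow_half_pos (re_one_sub_pos hz))
  rw [koebe, koebeInv]
  generalize (1 - 4 * z) ^ (1 / 2 : ℂ) = w at hsq h1
  have h2 : 1 + (1 - w) / (1 + w) = 2 / (1 + w) := by field_simp; ring
  rw [h2]
  field_simp
  linear_combination -hsq

theorem koebeInv_koebe {z : ℂ} (hz : ‖z‖ < 1) (hz' : ‖koebe z‖ < 1 / 4) :
    koebeInv (koebe z) = z :=
  koebe_injOn (mem_ball_zero_iff.2 (norm_koebeInv_lt_one hz')) (mem_ball_zero_iff.2 hz)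
    (koebe_koebeInv hz')

theorem norm_koebeInv_lt {ρ : ℝ} (h0 : 0 ≤ ρ) (h1 : ρ ≤ 1) {z : ℂ} (hz : ‖z‖ < koebe ρ) :
    ‖koebeInv z‖ < ρ := by
  have hz4 : ‖z‖ < 1 / 4 := hz.trans_le (koebe_le_quarter h0 h1)
  have hk := norm_koebeInv_lt_one hz4
  refine (koebe_strictMonoOn.lt_iff_lt ⟨norm_nonneg _, hk.le⟩ ⟨h0, h1⟩).1 ?_
  calc koebe ‖koebeInv z‖ ≤ ‖koebe (koebeInv z)‖ := koebe_norm_le hk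
    _ < koebe ρ := by rwa [koebe_koebeInv hz4]

theorem differentiableOn_koebeInv : DifferentiableOn ℂ koebeInv (ball 0 (1 / 4)) := by
  have hre : ∀ z ∈ ball (0 : ℂ) (1 / 4), 0 < (1 - 4 * z).re := fun z hz =>
    re_one_sub_pos (mem_ball_zero_iff.1 hz)
  have hw : DifferentiableOn ℂ (fun z : ℂ => (1 - 4 * z) ^ (1 / 2 : ℂ)) (ball 0 (1 / 4)) :=
    DifferentiableOn.cpow_const (by fun_prop) fun z hz => Or.inl (hre z hz)
  exact DifferentiableOn.div (by fun_prop) (by fun_prop) fun z hz =>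
    one_add_ne_zero_of_re_pos (re_cpow_half_pos (hre z hz))

theorem tendsto_coeff_of_simple_pole_koebe {c : ℕ → ℂ} {H : ℂ → ℂ} {b ρ : ℝ} (hb : 0 < b)
    (hbρ : b < ρ) (hρ : ρ < 1) (hH : DifferentiableOn ℂ H (ball 0 ρ))
    (hc : ∀ l : ℝ, 0 < l → l < b →
      ∃ s, HasSum (fun n => c n * koebe (l : ℂ) ^ n) s ∧
        (koebe (b : ℂ) - koebe (l : ℂ)) * s = H l) :
    Tendsto (fun n => c n * koebe (b : ℂ) ^ (n + 1)) atTop (𝓝 (H b)) := by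
  have hρ0 : 0 < ρ := hb.trans hbρ
  have hinv : ∀ l : ℝ, 0 < l → l ≤ b → koebeInv (koebe (l : ℂ)) = l := fun l h0 hl => by
    have hl1 : l < 1 := by linarith
    refine koebeInv_koebe (by rwa [Complex.norm_of_nonneg h0.le]) ?_
    rw [← ofReal_koebe, Complex.norm_of_nonneg (koebe_pos h0).le]
    exact (koebe_strictMonoOn ⟨h0.le, hl1.le⟩ ⟨zero_le_one, le_rfl⟩ hl1).trans_eq
      (by norm_num [koebe])
  have hnorm : ‖koebe (b : ℂ)‖ < koebe ρ := by
    rw [← ofReal_koebe, Complex.norm_of_nonneg (koebe_pos hb).le]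
    exact koebe_strictMonoOn ⟨hb.le, (hbρ.trans hρ).le⟩ ⟨hρ0.le, hρ.le⟩ hbρ
  have hcomp : DifferentiableOn ℂ (H ∘ koebeInv) (ball 0 (koebe ρ)) :=
    hH.comp (differentiableOn_koebeInv.mono (ball_subset_ball (koebe_le_quarter hρ0.le hρ.le)))
      fun z hz => mem_ball_zero_iff.2 (norm_koebeInv_lt hρ0.le hρ.le (mem_ball_zero_iff.1 hz))
  have h := tendsto_coeff_of_simple_pole (koebe_pos hb) hnorm hcomp fun x hx0 hxb => by
    obtain ⟨l, hl0, hlb, rfl⟩ := exists_koebe_eq hb.le hx0 hxb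
    simpa only [Function.comp_apply, ofReal_koebe, hinv l hl0 hlb.le] using hc l hl0 hlb
  simpa only [Function.comp_apply, hinv b hb le_rfl] using h

end Koebe

namespace PlanarTree

/-! ### Counting the extensions of a tree -/

/-- The number of ways to extend a tree with `K ≠ 0` vertices at its top level by `n` edges in such
a way that its height increases by exactly `m`; it is `0` for `K = 0`. -/
def extensionCount : ℕ → ℕ → ℕ → ℕ
  | 0, K, n => if n = 0 ∧ K ≠ 0 then 1 else 0
  | m + 1, K, n => ∑ p ∈ Finset.HasAntidiagonal.antidiagonal n,
      K.multichoose p.1 * extensionCount m p.1 p.2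

/-- The total weight of the extensions by `n` edges of a tree with `K` vertices at its top level,
each additional level being weighted by `a`. -/
noncomputable def extensionWeight (a : ℝ≥0∞) (K n : ℕ) : ℝ≥0∞ := ∑' m, a ^ m * extensionCount m K n

theorem extensionWeight_eq (a : ℝ≥0∞) (K n : ℕ) :
    extensionWeight a K n = (if n = 0 ∧ K ≠ 0 then 1 else 0) +
      a * ∑ p ∈ Finset.HasAntidiagonal.antidiagonal n,
        (K.multichoose p.1 : ℝ≥0∞) * extensionWeight a p.1 p.2 := by
  rw [extensionWeight, tsum_eq_zero_add' ENNReal.summable]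
  congr 1
  · simp [extensionCount]
  · simp_rw [extensionCount, extensionWeight, Nat.cast_sum, Finset.mul_sum,
      ← ENNReal.tsum_mul_left]
    rw [Summable.tsum_finsetSum fun _ _ => ENNReal.summable]
    refine Finset.sum_congr rfl fun p _ => tsum_congr fun m => ?_
    push_cast
    ring

theorem extensionCount_zero : ∀ m n, extensionCount m 0 n = 0
  | 0, _ => if_neg fun h => h.2 rfl
  | m + 1, n => by
    refine Finset.sum_eq_zero fun p _ => ?_
    cases hp : p.1 with
    | zero => rw [extensionCount_zero, mul_zero]
    | succ j => rw [Nat.multichoose_zero_succ, zero_mul]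

theorem extensionWeight_zero (a : ℝ≥0∞) (n : ℕ) : extensionWeight a 0 n = 0 := by
  simp [extensionWeight, extensionCount_zero]

theorem extensionWeight_eq_tsum (a : ℝ≥0∞) {K : ℕ} (hK : K ≠ 0) (n : ℕ) :
    extensionWeight a K n = ∑' L, (K.multichoose L : ℝ≥0∞) *
      if L = 0 then (if n = 0 then 1 else 0) else
        if L ≤ n then a * extensionWeight a L (n - L) else 0 := by
  rw [extensionWeight_eq, tsum_eq_sum (s := Finset.range (n + 1)) (by
    intro L hL
    rw [Finset.mem_range, not_lt] at hL
    rw [if_neg (by omega), if_neg (by omega), mul_zero]),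
    Finset.Nat.sum_antidiagonal_eq_sum_range_succ_mk, Finset.sum_range_succ',
    Finset.sum_range_succ', extensionWeight_zero]
  simp only [hK, ne_eq, not_false_eq_true, and_true, mul_zero, add_zero, if_true,
    Nat.multichoose_zero_right, Nat.cast_one, one_mul, Finset.mul_sum]
  rw [add_comm]
  refine congrArg (· + _) (Finset.sum_congr rfl fun L hL => ?_)
  rw [if_neg L.succ_ne_zero, if_pos (Nat.succ_le_of_lt (Finset.mem_range.1 hL)), mul_left_comm]

theorem tsum_extensionCount_succ_mul_pow (m K : ℕ) (x : ℝ≥0∞) :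
    ∑' n, extensionCount (m + 1) K n * x ^ n =
      ∑' i, K.multichoose i * x ^ i * ∑' n, extensionCount m i n * x ^ n := by
  simp_rw [← ENNReal.tsum_mul_left]
  rw [← tsum_sum_antidiagonal fun i n =>
    (K.multichoose i : ℝ≥0∞) * x ^ i * (extensionCount m i n * x ^ n)]
  refine tsum_congr fun n => ?_
  rw [extensionCount, Nat.cast_sum, Finset.sum_mul]
  refine Finset.sum_congr rfl fun p hp => ?_
  rw [← Finset.HasAntidiagonal.mem_antidiagonal.1 hp]
  push_cast
  ring

/-- The generating function, in the variable `x = koebe l`, of the planar trees of height less than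
`m` hanging from a vertex: it solves `X₀ = 0`, `Xₘ₊₁ = 1 / (1 - x Xₘ)`. -/
def boundedHeightGF {𝕜 : Type*} [Field 𝕜] (l : 𝕜) (m : ℕ) : 𝕜 :=
  (1 + l) * (1 - l ^ m) / (1 - l ^ (m + 1))

@[simp]
theorem boundedHeightGF_zero {𝕜 : Type*} [Field 𝕜] (l : 𝕜) : boundedHeightGF l 0 = 0 := by
  simp [boundedHeightGF]

@[norm_cast]
theorem ofReal_boundedHeightGF (l : ℝ) (m : ℕ) :
    ((boundedHeightGF l m : ℝ) : ℂ) = boundedHeightGF (l : ℂ) m := by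
  simp only [boundedHeightGF]
  push_cast
  rfl

section Real

variable {l : ℝ}

theorem one_sub_pow_succ_pos (h0 : 0 < l) (h1 : l < 1) (m : ℕ) : 0 < 1 - l ^ (m + 1) :=
  sub_pos.2 (pow_lt_one₀ h0.le h1 m.succ_ne_zero)

theorem one_sub_koebe_mul_boundedHeightGF (h0 : 0 < l) (h1 : l < 1) (m : ℕ) :
    1 - koebe l * boundedHeightGF l m = (boundedHeightGF l (m + 1))⁻¹ := by
  have h2 := (one_sub_pow_succ_pos h0 h1 m).ne'
  have := (one_sub_pow_succ_pos h0 h1 (m + 1)).ne'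
  rw [koebe, boundedHeightGF, boundedHeightGF, inv_div]
  field_simp
  ring

theorem boundedHeightGF_one (h0 : 0 < l) (h1 : l < 1) : boundedHeightGF l 1 = 1 := by
  simpa using (one_sub_koebe_mul_boundedHeightGF h0 h1 0).symm

theorem boundedHeightGF_succ_pos (h0 : 0 < l) (h1 : l < 1) (m : ℕ) :
    0 < boundedHeightGF l (m + 1) :=
  div_pos (mul_pos (by linarith) (one_sub_pow_succ_pos h0 h1 m))
    (one_sub_pow_succ_pos h0 h1 (m + 1))

theorem boundedHeightGF_nonneg (h0 : 0 < l) (h1 : l < 1) : ∀ m, 0 ≤ boundedHeightGF l m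
  | 0 => (boundedHeightGF_zero l).ge
  | m + 1 => (boundedHeightGF_succ_pos h0 h1 m).le

theorem boundedHeightGF_le_succ (h0 : 0 < l) (h1 : l < 1) (m : ℕ) :
    boundedHeightGF l m ≤ boundedHeightGF l (m + 1) := by
  rw [boundedHeightGF, boundedHeightGF, div_le_div_iff₀ (one_sub_pow_succ_pos h0 h1 m)
    (one_sub_pow_succ_pos h0 h1 (m + 1)), mul_assoc, mul_assoc]
  refine mul_le_mul_of_nonneg_left (sub_nonneg.1 ?_) (by linarith)
  calc 0 ≤ l ^ m * (1 - l) ^ 2 := by positivity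
    _ = _ := by ring

theorem boundedHeightGF_pow_sub_nonneg (h0 : 0 < l) (h1 : l < 1) (m K : ℕ) :
    0 ≤ boundedHeightGF l (m + 1) ^ K - boundedHeightGF l m ^ K :=
  sub_nonneg.2 (pow_le_pow_left₀ (boundedHeightGF_nonneg h0 h1 m) (boundedHeightGF_le_succ h0 h1 m)
    K)

theorem hasSum_multichoose_boundedHeightGF (h0 : 0 < l) (h1 : l < 1) (K m : ℕ) :
    HasSum (fun L => (K.multichoose L : ℝ) * (koebe l * boundedHeightGF l m) ^ L)
      (boundedHeightGF l (m + 1) ^ K) := by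
  have hrec := one_sub_koebe_mul_boundedHeightGF h0 h1 m
  have hpos := inv_pos.2 (boundedHeightGF_succ_pos h0 h1 m)
  have h := hasSum_multichoose_mul_pow K (z := koebe l * boundedHeightGF l m) (by
    rw [Real.norm_of_nonneg (mul_nonneg (koebe_pos h0).le (boundedHeightGF_nonneg h0 h1 m))]
    linarith)
  rwa [hrec, inv_inv] at h

theorem tsum_extensionCount_mul_pow (h0 : 0 < l) (h1 : l < 1) (m : ℕ) : ∀ K,
    ∑' n, extensionCount m K n * ENNReal.ofReal (koebe l) ^ n =
      ENNReal.ofReal (boundedHeightGF l (m + 1) ^ K - boundedHeightGF l m ^ K) := by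
  induction m with
  | zero =>
    intro K
    rw [tsum_eq_single 0 (by intro n hn; simp [extensionCount, hn]), zero_add,
      boundedHeightGF_one h0 h1, boundedHeightGF_zero]
    rcases eq_or_ne K 0 with rfl | hK
    · simp [extensionCount]
    · simp [extensionCount, hK]
  | succ m ih =>
    intro K
    have hx := (koebe_pos h0).le
    have hterm : ∀ i, (K.multichoose i : ℝ≥0∞) * ENNReal.ofReal (koebe l) ^ i *
        ENNReal.ofReal (boundedHeightGF l (m + 1) ^ i - boundedHeightGF l m ^ i) =
        ENNReal.ofReal ((K.multichoose i : ℝ) * (koebe l * boundedHeightGF l (m + 1)) ^ i -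
          (K.multichoose i : ℝ) * (koebe l * boundedHeightGF l m) ^ i) := fun i => by
      rw [← ENNReal.ofReal_natCast, ← ENNReal.ofReal_pow hx, ← ENNReal.ofReal_mul (by positivity),
        ← ENNReal.ofReal_mul (by positivity)]
      ring_nf
    have hsum := (hasSum_multichoose_boundedHeightGF h0 h1 K (m + 1)).sub
      (hasSum_multichoose_boundedHeightGF h0 h1 K m)
    simp_rw [tsum_extensionCount_succ_mul_pow, ih, hterm]
    rw [← ENNReal.ofReal_tsum_of_nonneg (fun i => ?_) hsum.summable, hsum.tsum_eq]
    rw [mul_pow, mul_pow, ← mul_sub, ← mul_sub]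
    exact mul_nonneg (by positivity)
      (mul_nonneg (by positivity) (boundedHeightGF_pow_sub_nonneg h0 h1 m i))

end Real

/-! ### Singularity analysis -/

theorem exists_norm_one_sub_pow_sub_le (M : ℝ) (K : ℕ) :
    ∃ C : ℝ, 0 ≤ C ∧ ∀ e : ℂ, ‖e‖ ≤ M → ‖(1 - e) ^ K - (1 - K * e)‖ ≤ C * ‖e‖ ^ 2 := by
  induction K with
  | zero => exact ⟨0, le_rfl, fun e _ => by simp⟩
  | succ K ih =>
    obtain ⟨C, hC, h⟩ := ih
    refine ⟨(1 + |M|) * C + K, by positivity, fun e he => ?_⟩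
    have h1e : ‖1 - e‖ ≤ 1 + |M| :=
      (norm_sub_le _ _).trans (by rw [norm_one]; linarith [le_abs_self M])
    calc ‖(1 - e) ^ (K + 1) - (1 - (K + 1 : ℕ) * e)‖
        = ‖(1 - e) * ((1 - e) ^ K - (1 - K * e)) + K * e ^ 2‖ := by push_cast; ring_nf
      _ ≤ ‖1 - e‖ * ‖(1 - e) ^ K - (1 - K * e)‖ + K * ‖e‖ ^ 2 :=
        (norm_add_le _ _).trans_eq (by simp only [norm_mul, norm_pow, Complex.norm_natCast])
      _ ≤ (1 + |M|) * (C * ‖e‖ ^ 2) + K * ‖e‖ ^ 2 := by gcongr; exact h e he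
      _ = ((1 + |M|) * C + K) * ‖e‖ ^ 2 := by ring

/-- The relative contribution of the trees of height at least `m` to the generating function `1 + l`
of all planar trees. -/
noncomputable def heightTail (l : ℂ) (m : ℕ) : ℂ := l ^ m * (1 - l) / (1 - l ^ (m + 1))

/-- The difference between `boundedHeightGF l m ^ K` and its linearization in the leading term
`l ^ m * (1 - l)` of `heightTail l m`. -/
noncomputable def linearizationError (K : ℕ) (l : ℂ) (m : ℕ) : ℂ :=
  boundedHeightGF l m ^ K - (1 + l) ^ K * (1 - K * (l ^ m * (1 - l)))

/-- The part of the generating function of `extensionWeight b⁻¹ K` which, as a function of `l`, is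
holomorphic in a neighbourhood of `b`. -/
noncomputable def regularPart (b : ℝ) (K : ℕ) (l : ℂ) : ℂ :=
  ∑' m : ℕ, (b : ℂ)⁻¹ ^ m * (linearizationError K l (m + 1) - linearizationError K l m)

section Complex

variable {l : ℂ} {b ρ : ℝ}

theorem one_sub_pow_succ_ne_zero (hl : ‖l‖ < 1) (m : ℕ) : 1 - l ^ (m + 1) ≠ 0 := by
  refine sub_ne_zero.2 fun h => ?_
  have := pow_lt_one₀ (norm_nonneg l) hl m.succ_ne_zero
  rw [← norm_pow, ← h, norm_one] at this
  exact this.false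

theorem boundedHeightGF_eq_mul_one_sub_heightTail (hl : ‖l‖ < 1) (m : ℕ) :
    boundedHeightGF l m = (1 + l) * (1 - heightTail l m) := by
  have := one_sub_pow_succ_ne_zero hl m
  rw [boundedHeightGF, heightTail]
  field_simp
  ring

theorem heightTail_sub_leading_term (hl : ‖l‖ < 1) (m : ℕ) :
    heightTail l m - l ^ m * (1 - l) = l ^ (m + 1) * heightTail l m := by
  have := one_sub_pow_succ_ne_zero hl m
  rw [heightTail]
  field_simp
  ring

theorem norm_heightTail_le (hρ : ρ < 1) (hl : ‖l‖ ≤ ρ) (m : ℕ) :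
    ‖heightTail l m‖ ≤ 2 / (1 - ρ) * ρ ^ m := by
  have h0 : 0 ≤ ρ := (norm_nonneg l).trans hl
  have hden : 1 - ρ ≤ ‖1 - l ^ (m + 1)‖ := by
    calc 1 - ρ ≤ 1 - ‖l‖ ^ (m + 1) := by
          gcongr
          exact (pow_le_of_le_one (norm_nonneg l) (hl.trans hρ.le) m.succ_ne_zero).trans hl
      _ ≤ ‖1 - l ^ (m + 1)‖ := by
          simpa only [norm_one, norm_pow] using norm_sub_norm_le 1 (l ^ (m + 1))
  have hnum : ‖1 - l‖ ≤ 2 := (norm_sub_le _ _).trans (by rw [norm_one]; linarith)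
  have : 0 < 1 - ρ := by linarith
  calc ‖heightTail l m‖ = ‖l‖ ^ m * ‖1 - l‖ / ‖1 - l ^ (m + 1)‖ := by
        rw [heightTail, norm_div, norm_mul, norm_pow]
    _ ≤ ρ ^ m * 2 / (1 - ρ) := by gcongr
    _ = 2 / (1 - ρ) * ρ ^ m := by ring

theorem linearizationError_eq (hl : ‖l‖ < 1) (K m : ℕ) :
    linearizationError K l m =
      (1 + l) ^ K * (((1 - heightTail l m) ^ K - (1 - K * heightTail l m)) -
        K * (l ^ (m + 1) * heightTail l m)) := by
  rw [linearizationError, boundedHeightGF_eq_mul_one_sub_heightTail hl, mul_pow,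
    ← heightTail_sub_leading_term hl]
  ring

theorem exists_norm_linearizationError_le (hρ : ρ < 1) (K : ℕ) :
    ∃ C : ℝ, 0 ≤ C ∧ ∀ l : ℂ, ‖l‖ ≤ ρ → ∀ m, ‖linearizationError K l m‖ ≤ C * (ρ ^ 2) ^ m := by
  obtain ⟨C, hC, hquad⟩ := exists_norm_one_sub_pow_sub_le (2 / (1 - ρ)) K
  have : 0 < 1 - ρ := by linarith
  refine ⟨2 ^ K * (C * (2 / (1 - ρ)) ^ 2 + K * (2 / (1 - ρ))), by positivity, fun l hl m => ?_⟩
  have h0 : 0 ≤ ρ := (norm_nonneg _).trans hl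
  have htail := norm_heightTail_le hρ hl m
  have htail' : ‖heightTail l m‖ ≤ 2 / (1 - ρ) :=
    htail.trans (mul_le_of_le_one_right (by positivity) (pow_le_one₀ h0 hρ.le))
  have h1l : ‖1 + l‖ ≤ 2 := (norm_add_le _ _).trans (by rw [norm_one]; linarith)
  have hpow : ‖l‖ ^ (m + 1) ≤ ρ ^ m :=
    (pow_le_pow_of_le_one (norm_nonneg l) (hl.trans hρ.le) m.le_succ).trans
      (pow_le_pow_left₀ (norm_nonneg l) hl m)
  calc ‖linearizationError K l m‖
      ≤ ‖1 + l‖ ^ K * (‖(1 - heightTail l m) ^ K - (1 - K * heightTail l m)‖ +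
          K * (‖l‖ ^ (m + 1) * ‖heightTail l m‖)) := by
        rw [linearizationError_eq (hl.trans_lt hρ), norm_mul, norm_pow]
        gcongr
        exact (norm_sub_le _ _).trans_eq (by simp only [norm_mul, norm_pow, Complex.norm_natCast])
    _ ≤ 2 ^ K * (C * (2 / (1 - ρ) * ρ ^ m) ^ 2 + K * (ρ ^ m * (2 / (1 - ρ) * ρ ^ m))) := by
        gcongr
        exact (hquad _ htail').trans (by gcongr)
    _ = 2 ^ K * (C * (2 / (1 - ρ)) ^ 2 + K * (2 / (1 - ρ))) * (ρ ^ 2) ^ m := by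
        rw [← pow_mul, mul_comm 2 m, pow_mul]
        ring

theorem exists_norm_regularPart_term_le (hb : 0 < b) (hρ : ρ < 1) (K : ℕ) :
    ∃ C : ℝ, ∀ l : ℂ, ‖l‖ ≤ ρ → ∀ m,
      ‖(b : ℂ)⁻¹ ^ m * (linearizationError K l (m + 1) - linearizationError K l m)‖ ≤
        C * (b⁻¹ * ρ ^ 2) ^ m := by
  obtain ⟨C, hC, hle⟩ := exists_norm_linearizationError_le hρ K
  refine ⟨2 * C, fun l hl m => ?_⟩
  have h0 : 0 ≤ ρ := (norm_nonneg _).trans hl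
  calc _ = b⁻¹ ^ m * ‖linearizationError K l (m + 1) - linearizationError K l m‖ := by
        rw [norm_mul, norm_pow, norm_inv, Complex.norm_of_nonneg hb.le]
    _ ≤ b⁻¹ ^ m * (C * (ρ ^ 2) ^ m + C * (ρ ^ 2) ^ m) := by
        gcongr
        refine (norm_sub_le _ _).trans (add_le_add ((hle l hl (m + 1)).trans ?_) (hle l hl m))
        gcongr C * ?_
        exact pow_le_pow_of_le_one (by positivity) (pow_le_one₀ h0 hρ.le) m.le_succ
    _ = 2 * C * (b⁻¹ * ρ ^ 2) ^ m := by rw [mul_pow b⁻¹]; ring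

theorem summable_inv_mul_sq_pow (hb : 0 < b) (hρb : ρ ^ 2 < b) (C : ℝ) :
    Summable fun m : ℕ => C * (b⁻¹ * ρ ^ 2) ^ m :=
  (summable_geometric_of_lt_one (by positivity) ((inv_mul_lt_one₀ hb).2 hρb)).mul_left C

theorem differentiableOn_linearizationError (hρ : ρ ≤ 1) (K m : ℕ) :
    DifferentiableOn ℂ (linearizationError K · m) (Metric.ball 0 ρ) := by
  have : DifferentiableOn ℂ (fun l : ℂ => boundedHeightGF l m) (Metric.ball 0 ρ) :=
    DifferentiableOn.div (by fun_prop) (by fun_prop) fun l hl =>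
      one_sub_pow_succ_ne_zero ((mem_ball_zero_iff.1 hl).trans_le hρ) m
  unfold linearizationError
  fun_prop

theorem differentiableOn_regularPart (hb : 0 < b) (hρ : ρ < 1) (hρb : ρ ^ 2 < b) (K : ℕ) :
    DifferentiableOn ℂ (regularPart b K) (Metric.ball 0 ρ) := by
  obtain ⟨C, hC⟩ := exists_norm_regularPart_term_le hb hρ K
  exact Complex.differentiableOn_tsum_of_summable_norm (summable_inv_mul_sq_pow hb hρb C)
    (fun m => ((differentiableOn_linearizationError hρ.le K (m + 1)).sub
      (differentiableOn_linearizationError hρ.le K m)).const_mul _) Metric.isOpen_ball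
    fun m l hl => hC l (mem_ball_zero_iff.1 hl).le m

/-- The linearization contributes a geometric series with ratio `l / b`, the pole at `l = b`; the
linearization errors are `O(l ^ 2) ^ m` and contribute no singularity in `|l| ^ 2 < b`. -/
theorem hasSum_boundedHeightGF_pow_sub (hb : 0 < b) (hb1 : b < 1) (hl : ‖l‖ < b) (K : ℕ) :
    HasSum (fun m => (b : ℂ)⁻¹ ^ m * (boundedHeightGF l (m + 1) ^ K - boundedHeightGF l m ^ K))
      (K * (1 + l) ^ K * (1 - l) ^ 2 * (1 - (b : ℂ)⁻¹ * l)⁻¹ + regularPart b K l) := by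
  obtain ⟨C, hC⟩ := exists_norm_regularPart_term_le hb hb1 K
  have hreg : HasSum _ (regularPart b K l) := (Summable.of_norm_bounded
    (summable_inv_mul_sq_pow hb (by nlinarith) C) (hC l hl.le)).hasSum
  have hratio : ‖(b : ℂ)⁻¹ * l‖ < 1 := by
    rwa [norm_mul, norm_inv, Complex.norm_of_nonneg hb.le, inv_mul_lt_one₀ hb]
  refine (((hasSum_geometric_of_norm_lt_one hratio).mul_left
    (K * (1 + l) ^ K * (1 - l) ^ 2)).add hreg).congr_fun fun m => ?_
  simp only [linearizationError, mul_pow]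
  ring

end Complex

section Asymptotics

variable {b l : ℝ}

theorem tsum_extensionWeight_mul_pow (hb : 0 < b) (h0 : 0 < l) (h1 : l < 1) {K : ℕ}
    (hs : Summable fun m =>
      b⁻¹ ^ m * (boundedHeightGF l (m + 1) ^ K - boundedHeightGF l m ^ K)) :
    ∑' n, extensionWeight (ENNReal.ofReal b⁻¹) K n * ENNReal.ofReal (koebe l) ^ n =
      ENNReal.ofReal
        (∑' m, b⁻¹ ^ m * (boundedHeightGF l (m + 1) ^ K - boundedHeightGF l m ^ K)) := by
  have hb' : 0 ≤ b⁻¹ := by positivity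
  simp_rw [extensionWeight, ← ENNReal.tsum_mul_right]
  rw [ENNReal.tsum_comm, ENNReal.ofReal_tsum_of_nonneg (fun m =>
    mul_nonneg (by positivity) (boundedHeightGF_pow_sub_nonneg h0 h1 m K)) hs]
  refine tsum_congr fun m => ?_
  simp_rw [mul_assoc]
  rw [ENNReal.tsum_mul_left, tsum_extensionCount_mul_pow h0 h1, ENNReal.ofReal_mul (by positivity),
    ENNReal.ofReal_pow hb']

theorem hasSum_toReal_of_tsum_mul_pow_eq_ofReal {f : ℕ → ℝ≥0∞} {x s : ℝ} (hx : 0 ≤ x) (hs : 0 ≤ s)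
    (h : ∑' n, f n * ENNReal.ofReal x ^ n = ENNReal.ofReal s) :
    HasSum (fun n => (f n).toReal * x ^ n) s := by
  have h' := ENNReal.hasSum_toReal (h.trans_ne ENNReal.ofReal_ne_top)
  rw [← ENNReal.tsum_toReal_eq (ENNReal.ne_top_of_tsum_ne_top (h.trans_ne ENNReal.ofReal_ne_top)),
    h, ENNReal.toReal_ofReal hs] at h'
  simpa only [ENNReal.toReal_mul, ENNReal.toReal_pow, ENNReal.toReal_ofReal hx] using h'

theorem summable_boundedHeightGF_pow_sub (hb1 : b < 1) (h0 : 0 < l) (hl : l < b) (K : ℕ) :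
    Summable fun m => b⁻¹ ^ m * (boundedHeightGF l (m + 1) ^ K - boundedHeightGF l m ^ K) := by
  have h := (hasSum_boundedHeightGF_pow_sub (l := (l : ℂ)) (h0.trans hl) hb1
    (by rwa [Complex.norm_of_nonneg h0.le]) K).summable
  exact Complex.summable_ofReal.1 (h.congr fun m => by push_cast; rfl)

theorem extensionWeight_ne_top (hb : 0 < b) (hb1 : b < 1) (K n : ℕ) :
    extensionWeight (ENNReal.ofReal b⁻¹) K n ≠ ∞ := by
  have h0 := half_pos hb
  have hl := half_lt_self hb
  intro htop
  have h := ENNReal.ne_top_of_tsum_ne_top ((tsum_extensionWeight_mul_pow hb h0 (hl.trans hb1)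
    (summable_boundedHeightGF_pow_sub hb1 h0 hl K)).trans_ne ENNReal.ofReal_ne_top) n
  rw [htop, ENNReal.top_mul (pow_ne_zero n (ENNReal.ofReal_pos.2 (koebe_pos h0)).ne')] at h
  exact h rfl

theorem hasSum_extensionWeight_mul_pow (hb1 : b < 1) (h0 : 0 < l) (hl : l < b) (K : ℕ) :
    HasSum (fun n => ((extensionWeight (ENNReal.ofReal b⁻¹) K n).toReal : ℂ) * koebe (l : ℂ) ^ n)
      (K * (1 + (l : ℂ)) ^ K * (1 - (l : ℂ)) ^ 2 * (1 - (b : ℂ)⁻¹ * l)⁻¹ + regularPart b K l) := by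
  have hb : 0 < b := h0.trans hl
  have hs := summable_boundedHeightGF_pow_sub hb1 h0 hl K
  have hsum := hasSum_toReal_of_tsum_mul_pow_eq_ofReal (koebe_pos h0).le
    (tsum_nonneg fun m => mul_nonneg (by positivity)
      (boundedHeightGF_pow_sub_nonneg h0 (hl.trans hb1) m K))
    (tsum_extensionWeight_mul_pow hb h0 (hl.trans hb1) hs)
  have hcomplex := hasSum_boundedHeightGF_pow_sub (l := (l : ℂ)) hb hb1
    (by rwa [Complex.norm_of_nonneg h0.le]) K
  rw [← hcomplex.tsum_eq]
  convert! Complex.hasSum_ofReal.2 hsum using 1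
  · funext n
    push_cast
    rfl
  · push_cast
    rfl

/-- The constant in `tendsto_extensionWeight`, from the residue of the generating function at its
dominant singularity `koebe b`. -/
noncomputable def poleConst (b : ℝ) : ℝ := b * (1 - b) ^ 3 / (1 + b) ^ 3

theorem poleConst_pos (hb : 0 < b) (hb1 : b < 1) : 0 < poleConst b := by
  have : 0 < 1 - b := by linarith
  unfold poleConst
  positivity

/-- The generating function of `extensionWeight b⁻¹ K`, as a function of `l` with `x = koebe l`,
multiplied by `koebe b - koebe l`. -/
noncomputable def poleNumerator (b : ℝ) (K : ℕ) (l : ℂ) : ℂ :=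
  K * (1 + l) ^ K * (1 - l) ^ 2 * (b * (1 - b * l) / ((1 + (b : ℂ)) ^ 2 * (1 + l) ^ 2)) +
    (koebe (b : ℂ) - koebe l) * regularPart b K l

theorem one_add_ofReal_ne_zero {x : ℝ} (hx : 0 < x) : 1 + (x : ℂ) ≠ 0 := by
  exact_mod_cast (by positivity : 1 + x ≠ 0)

theorem poleNumerator_self (hb : 0 < b) (K : ℕ) :
    poleNumerator b K b = ((K * (1 + b) ^ K * poleConst b : ℝ) : ℂ) := by
  have := one_add_ofReal_ne_zero hb
  rw [poleNumerator, poleConst, sub_self, zero_mul, add_zero]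
  push_cast
  field_simp
  ring

theorem koebe_sub_mul_eq_poleNumerator (h0 : 0 < l) (hl : l < b) (K : ℕ) :
    (koebe (b : ℂ) - koebe (l : ℂ)) *
      (K * (1 + (l : ℂ)) ^ K * (1 - (l : ℂ)) ^ 2 * (1 - (b : ℂ)⁻¹ * l)⁻¹ + regularPart b K l) =
      poleNumerator b K l := by
  have hb : (b : ℂ) ≠ 0 := by exact_mod_cast (h0.trans hl).ne'
  have hlb : (b : ℂ) - l ≠ 0 := by exact_mod_cast (sub_pos.2 hl).ne'
  have hinv : (1 - (b : ℂ)⁻¹ * l)⁻¹ = b / (b - l) := by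
    rw [← inv_div, sub_div, div_self hb, div_eq_inv_mul]
  have hb1 := one_add_ofReal_ne_zero (h0.trans hl)
  have hl1 := one_add_ofReal_ne_zero h0
  rw [poleNumerator, hinv, mul_add, koebe_sub_koebe hb1 hl1]
  congr 1
  field_simp

theorem differentiableOn_poleNumerator {ρ : ℝ} (hb : 0 < b) (hρ : ρ < 1) (hρb : ρ ^ 2 < b) (K : ℕ) :
    DifferentiableOn ℂ (poleNumerator b K) (Metric.ball 0 ρ) := by
  have hb1 := one_add_ofReal_ne_zero hb
  have hne : ∀ l ∈ Metric.ball (0 : ℂ) ρ, 1 + l ≠ 0 := fun l hl =>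
    one_add_ne_zero_of_norm_lt_one ((mem_ball_zero_iff.1 hl).trans hρ)
  have hkoebe : DifferentiableOn ℂ (koebe : ℂ → ℂ) (Metric.ball 0 ρ) :=
    DifferentiableOn.div (by fun_prop) (by fun_prop) fun l hl => pow_ne_zero 2 (hne l hl)
  have hfactor : DifferentiableOn ℂ
      (fun l : ℂ => b * (1 - b * l) / ((1 + (b : ℂ)) ^ 2 * (1 + l) ^ 2)) (Metric.ball 0 ρ) :=
    DifferentiableOn.fun_div (by fun_prop) (by fun_prop) fun l hl =>
      mul_ne_zero (pow_ne_zero 2 hb1) (pow_ne_zero 2 (hne l hl))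
  have hreg := differentiableOn_regularPart hb hρ hρb K
  unfold poleNumerator
  fun_prop

theorem tendsto_extensionWeight (hb : 0 < b) (hb1 : b < 1) (K : ℕ) :
    Tendsto (fun n => (extensionWeight (ENNReal.ofReal b⁻¹) K n).toReal * koebe b ^ (n + 1)) atTop
      (𝓝 (K * (1 + b) ^ K * poleConst b)) := by
  obtain ⟨ρ, hbρ, hρb⟩ := exists_between (Real.lt_sqrt_of_sq_lt (by nlinarith : b ^ 2 < b))
  have hρb' : ρ ^ 2 < b := (Real.lt_sqrt (hb.trans hbρ).le).1 hρb
  have hρ1 : ρ < 1 := by nlinarith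
  have h := tendsto_coeff_of_simple_pole_koebe hb hbρ hρ1
    (differentiableOn_poleNumerator hb hρ1 hρb' K) fun l h0 hl =>
      ⟨_, hasSum_extensionWeight_mul_pow hb1 h0 hl K, koebe_sub_mul_eq_poleNumerator h0 hl K⟩
  rw [poleNumerator_self hb] at h
  norm_cast at h
  exact tendsto_ofReal_iff.1 h

end Asymptotics

/-! ### Generations -/

/-- A possible next generation of a tree whose top level has `K` vertices, encoded by its sorted
list of parents. -/
def Generation (K : ℕ) : Type := {ℓ : List ℕ // ℓ.Pairwise (· ≤ ·) ∧ ∀ p ∈ ℓ, p < K}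

namespace Generation

instance (K : ℕ) : Countable (Generation K) := inferInstanceAs (Countable (Subtype _))

instance (K : ℕ) : MeasurableSpace (Generation K) := ⊤

instance (K : ℕ) : DiscreteMeasurableSpace (Generation K) := ⟨fun _ => trivial⟩

/-- The number of vertices of a generation. -/
def length {K : ℕ} (ℓ : Generation K) : ℕ := ℓ.1.length

/-- The generation without vertices. -/
def empty (K : ℕ) : Generation K := ⟨[], List.Pairwise.nil, by simp⟩

theorem length_eq_zero {K : ℕ} {ℓ : Generation K} : ℓ.length = 0 ↔ ℓ = empty K := by
  rw [length, List.length_eq_zero_iff]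
  exact ⟨fun h => Subtype.ext h, fun h => congrArg Subtype.val h⟩

/-- The generation in which the multiplicity of a parent in `m` is the number of its children. -/
def ofMultiset {K : ℕ} (m : Multiset (Fin K)) : Generation K :=
  ⟨(m.sort (· ≤ ·)).map Fin.val, by
    rw [List.pairwise_map]
    exact (m.pairwise_sort (· ≤ ·)).imp id, fun p hp => by
    obtain ⟨q, -, rfl⟩ := List.mem_map.1 hp
    exact q.2⟩

theorem length_ofMultiset {K : ℕ} (m : Multiset (Fin K)) : (ofMultiset m).length = m.card :=
  (List.length_map _).trans (Multiset.length_sort _)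

theorem ofMultiset_bijective (K : ℕ) :
    Function.Bijective (ofMultiset : Multiset (Fin K) → Generation K) := by
  constructor
  · intro m m' h
    have h_sort := List.map_injective_iff.2 Fin.val_injective (congrArg Subtype.val h)
    rw [← m.sort_eq (· ≤ ·), ← m'.sort_eq (· ≤ ·), h_sort]
  · rintro ⟨ℓ, h_sorted, hlt⟩
    lift ℓ to List (Fin K) using hlt
    rw [List.pairwise_map] at h_sorted
    refine ⟨ℓ, Subtype.ext (congrArg (List.map Fin.val) ?_)⟩
    refine List.Perm.eq_of_pairwise' (r := (· ≤ ·)) (Multiset.pairwise_sort _ _) h_sorted ?_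
    rw [← Multiset.coe_eq_coe, Multiset.sort_eq]

theorem tsum_comp_length (K : ℕ) (φ : ℕ → ℝ≥0∞) :
    ∑' ℓ : Generation K, φ ℓ.length = ∑' L, (K.multichoose L : ℝ≥0∞) * φ L := by
  calc ∑' ℓ : Generation K, φ ℓ.length
      = ∑' m : Multiset (Fin K), φ m.card := by
        rw [← (Equiv.ofBijective _ (ofMultiset_bijective K)).tsum_eq]
        simp only [Equiv.ofBijective_apply, length_ofMultiset]
    _ = ∑' L, ∑' m : Sym (Fin K) L, φ L := by
        rw [← (Equiv.sigmaFiberEquiv (Multiset.card (α := Fin K))).tsum_eq, ENNReal.tsum_sigma']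
        exact tsum_congr fun L => tsum_congr fun m => congrArg φ m.2
    _ = ∑' L, (K.multichoose L : ℝ≥0∞) * φ L := by
        refine tsum_congr fun L => ?_
        rw [tsum_fintype, Finset.sum_const, Finset.card_univ, Sym.card_sym_eq_multichoose,
          Fintype.card_fin, nsmul_eq_mul]

end Generation

/-! ### Cylinders -/

/-- The cylinder of the trees that agree with `T` up to height `r`. -/
def cylinder (T : PlanarTree) (r : ℕ) : Set PlanarTree :=
  {T' | ∀ s < r, T'.parents s = T.parents s}

/-- The cylinders of positive height, which form a countable basis of the topology. -/
def cylinders : Set (Set PlanarTree) := {s | ∃ (T : PlanarTree) (r : ℕ), s = T.cylinder (r + 1)}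

theorem self_mem_cylinder (T : PlanarTree) (r : ℕ) : T ∈ T.cylinder r := fun _ _ => rfl

theorem cylinder_eq_of_mem {T T' : PlanarTree} {r : ℕ} (h : T' ∈ T.cylinder r) :
    T'.cylinder r = T.cylinder r := by
  ext T''
  exact ⟨fun h' s hs => (h' s hs).trans (h s hs), fun h' s hs => (h' s hs).trans (h s hs).symm⟩

theorem cylinder_antitone (T : PlanarTree) : Antitone T.cylinder :=
  fun _ _ h _ h' s hs => h' s (hs.trans_le h)

theorem cylinder_one (T : PlanarTree) : T.cylinder 1 = Set.univ := by
  refine Set.eq_univ_of_forall fun T' s hs => ?_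
  obtain rfl := Nat.lt_one_iff.1 hs
  rw [T.parents_zero, T'.parents_zero]

theorem ball_subset_cylinder (T : PlanarTree) (r : ℕ) :
    Metric.ball T (1 / ((r : ℝ) + 1)) ⊆ T.cylinder r := by
  intro T' h
  obtain ⟨r', hr', hlt, h_ball⟩ := exists_of_dist_lt (Metric.mem_ball.1 h)
  have hr'_pos : (0 : ℝ) < r' := by exact_mod_cast hr'
  have h_lt : r + 1 < r' := by
    exact_mod_cast (one_div_lt_one_div hr'_pos (by positivity)).1 hlt
  exact fun s hs => ball_eq_iff.1 h_ball s (by omega)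

theorem isOpen_cylinder (T : PlanarTree) (r : ℕ) : IsOpen (T.cylinder r) := by
  refine Metric.isOpen_iff.2 fun T' h => ⟨1 / ((r : ℝ) + 1), by positivity, ?_⟩
  rw [← cylinder_eq_of_mem h]
  exact ball_subset_cylinder T' r

theorem cylinder_mem_nhds (T : PlanarTree) (r : ℕ) : T.cylinder r ∈ 𝓝 T :=
  (isOpen_cylinder T r).mem_nhds (self_mem_cylinder T r)

theorem measurableSet_cylinder (T : PlanarTree) (r : ℕ) : MeasurableSet (T.cylinder r) :=
  (isOpen_cylinder T r).measurableSet

theorem exists_cylinder_subset {U : Set PlanarTree} (hU : IsOpen U) {T : PlanarTree}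
    (hT : T ∈ U) : ∃ r, T.cylinder (r + 1) ⊆ U := by
  obtain ⟨ε, hε, h_ball⟩ := Metric.isOpen_iff.1 hU T hT
  obtain ⟨n, hn⟩ := exists_nat_one_div_lt hε
  refine ⟨n, fun T' hT' => h_ball (Metric.mem_ball.2 ?_)⟩
  refine (dist_le_of_ball_eq (r := n + 1) (by omega) (ball_eq_iff.2 hT')).trans_lt ?_
  exact_mod_cast hn

theorem isPiSystem_cylinders : IsPiSystem cylinders := by
  rintro _ ⟨T, r, rfl⟩ _ ⟨T', r', rfl⟩ ⟨T'', h, h'⟩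
  rw [← cylinder_eq_of_mem h, ← cylinder_eq_of_mem h']
  rcases le_total r r' with hr | hr
  · exact ⟨T'', r', Set.inter_eq_right.2 (cylinder_antitone _ (by omega))⟩
  · exact ⟨T'', r, Set.inter_eq_left.2 (cylinder_antitone _ (by omega))⟩

theorem isTopologicalBasis_cylinders : TopologicalSpace.IsTopologicalBasis cylinders := by
  refine TopologicalSpace.isTopologicalBasis_of_isOpen_of_nhds ?_ fun T U hT hU => ?_
  · rintro _ ⟨T, r, rfl⟩
    exact isOpen_cylinder T _
  · obtain ⟨r, hr⟩ := exists_cylinder_subset hU hT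
    exact ⟨_, ⟨T, r, rfl⟩, self_mem_cylinder T _, hr⟩

theorem countable_range_cylinder (r : ℕ) :
    (Set.range fun T : PlanarTree => T.cylinder r).Countable := by
  have h_parents : (Set.range fun (T : PlanarTree) (s : Fin r) => T.parents s).Countable :=
    Set.to_countable _
  refine (h_parents.image fun c => {T | ∀ s : Fin r, T.parents s = c s}).mono ?_
  rintro _ ⟨T, rfl⟩
  refine ⟨_, ⟨T, rfl⟩, ?_⟩
  ext T'
  exact ⟨fun h s hs => h ⟨s, hs⟩, fun h s => h s s.2⟩

theorem countable_cylinders : cylinders.Countable := by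
  refine (Set.countable_iUnion fun r => countable_range_cylinder (r + 1)).mono ?_
  rintro _ ⟨T, r, rfl⟩
  exact Set.mem_iUnion.2 ⟨r, T, rfl⟩

instance : SecondCountableTopology PlanarTree :=
  isTopologicalBasis_cylinders.secondCountableTopology countable_cylinders

theorem eq_generateFrom_cylinders :
    (inferInstance : MeasurableSpace PlanarTree) = MeasurableSpace.generateFrom cylinders :=
  isTopologicalBasis_cylinders.borel_eq_generateFrom

/-- The generation at height `r + 2`. -/
def generation (T : PlanarTree) (r : ℕ) : Generation (T.width (r + 1)) :=
  ⟨T.parents (r + 1), T.parents_mono _, T.parents_lt r⟩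

theorem generation_length (T : PlanarTree) (r : ℕ) :
    (T.generation r).length = T.width (r + 2) := rfl

/-- The tree of height at most `r + 2` which agrees with `T` up to height `r + 1` and whose
generation at height `r + 2` is `ℓ`. -/
def extend (T : PlanarTree) (r : ℕ) (ℓ : Generation (T.width (r + 1))) : PlanarTree where
  parents s := if s ≤ r then T.parents s else if s = r + 1 then ℓ.1 else []
  parents_zero := by simp [T.parents_zero]
  parents_mono s := by
    split_ifs
    exacts [T.parents_mono s, ℓ.2.1, List.Pairwise.nil]
  parents_lt s p hp := by
    rcases lt_trichotomy s r with h | rfl | h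
    · rw [if_pos (by omega)] at hp ⊢
      exact T.parents_lt s p hp
    · rw [if_neg (by omega), if_pos rfl] at hp
      rw [if_pos le_rfl]
      exact ℓ.2.2 p hp
    · rw [if_neg (by omega), if_neg (by omega)] at hp
      exact absurd hp List.not_mem_nil

section Extend

variable (T : PlanarTree) (r : ℕ) (ℓ : Generation (T.width (r + 1)))

theorem extend_mem_cylinder : T.extend r ℓ ∈ T.cylinder (r + 1) :=
  fun _ hs => if_pos (Nat.lt_succ_iff.1 hs)

theorem extend_parents_succ : (T.extend r ℓ).parents (r + 1) = ℓ.1 := by simp [extend]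

theorem extend_width : (T.extend r ℓ).width (r + 2) = ℓ.length :=
  congrArg List.length (extend_parents_succ T r ℓ)

end Extend

theorem mem_cylinder_extend {T T' : PlanarTree} {r : ℕ} {ℓ : Generation (T.width (r + 1))} :
    T' ∈ (T.extend r ℓ).cylinder (r + 2) ↔
      T' ∈ T.cylinder (r + 1) ∧ T'.parents (r + 1) = ℓ.1 := by
  rw [← cylinder_eq_of_mem (extend_mem_cylinder T r ℓ), ← extend_parents_succ T r ℓ]
  exact Nat.forall_lt_succ_right

theorem iUnion_cylinder_extend (T : PlanarTree) (r : ℕ) :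
    ⋃ ℓ, (T.extend r ℓ).cylinder (r + 2) = T.cylinder (r + 1) := by
  ext T'
  simp only [Set.mem_iUnion, mem_cylinder_extend]
  refine ⟨fun ⟨_, h, _⟩ => h, fun h => ⟨⟨T'.parents (r + 1), T'.parents_mono _, ?_⟩, h, rfl⟩⟩
  rw [width, ← h r (Nat.lt_succ_self r)]
  exact T'.parents_lt r

theorem pairwise_disjoint_cylinder_extend (T : PlanarTree) (r : ℕ) :
    Pairwise (Function.onFun Disjoint fun ℓ => (T.extend r ℓ).cylinder (r + 2)) := by
  refine fun ℓ ℓ' h => Set.disjoint_left.2 fun T' hT hT' => h (Subtype.ext ?_)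
  rw [← (mem_cylinder_extend.1 hT).2, (mem_cylinder_extend.1 hT').2]

theorem measure_cylinder_eq_tsum (ν : Measure PlanarTree) (T : PlanarTree) (r : ℕ) :
    ν (T.cylinder (r + 1)) = ∑' ℓ, ν ((T.extend r ℓ).cylinder (r + 2)) := by
  rw [← iUnion_cylinder_extend, measure_iUnion (pairwise_disjoint_cylinder_extend T r)
    fun ℓ => measurableSet_cylinder _ _]

/-! ### Size and height -/

/-- The number of edges of `T` below height `r`. It is `|B_r(T)|`, also for `r = 0` where
`ballVolume` has the value of `r = 1`. -/
def edgeCount (T : PlanarTree) (r : ℕ) : ℕ := ∑ s ∈ Finset.range r, T.width (s + 1)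

/-- The set of edges of `T` below height `r`, as a finite set. -/
def edgesBelow (T : PlanarTree) (r : ℕ) : Finset (ℕ × ℕ) :=
  ((Finset.range r).sigma fun s => Finset.range (T.width (s + 1))).map
    (Equiv.sigmaEquivProd ℕ ℕ).toEmbedding

theorem mem_edgesBelow {T : PlanarTree} {r : ℕ} {e : ℕ × ℕ} :
    e ∈ T.edgesBelow r ↔ e.1 < r ∧ e ∈ T.edges := by
  simp [edgesBelow, edges, Finset.mem_map_equiv, Equiv.sigmaEquivProd]

theorem card_edgesBelow (T : PlanarTree) (r : ℕ) : (T.edgesBelow r).card = T.edgeCount r := by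
  simp [edgesBelow, edgeCount]

theorem edgeCount_le_size (T : PlanarTree) (r : ℕ) : (T.edgeCount r : ℕ∞) ≤ T.size := by
  rw [← card_edgesBelow, ← Set.encard_coe_eq_coe_finsetCard]
  exact Set.encard_le_encard fun e he => (mem_edgesBelow.1 he).2

theorem edges_eq_edgesBelow {T : PlanarTree} {r : ℕ} (h : ∀ s, r < s → T.width s = 0) :
    T.edges = T.edgesBelow r := by
  ext e
  rw [Finset.mem_coe, mem_edgesBelow, iff_and_self]
  intro (he : e.2 < T.width (e.1 + 1))
  by_contra! hle
  rw [h _ (by omega)] at he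
  omega

theorem width_succ_eq_zero {T : PlanarTree} {s : ℕ} (h : T.width s = 0) :
    T.width (s + 1) = 0 := by
  cases s with
  | zero => exact absurd h one_ne_zero
  | succ s =>
    rw [width] at h
    rw [width, List.length_eq_zero_iff, List.eq_nil_iff_forall_not_mem]
    intro p hp
    have := T.parents_lt s p hp
    omega

theorem width_eq_zero_of_le {T : PlanarTree} {s t : ℕ} (h : T.width s = 0) (hst : s ≤ t) :
    T.width t = 0 :=
  Nat.le_induction h (fun _ _ => width_succ_eq_zero) t hst

theorem size_eq_edgeCount {T : PlanarTree} {r : ℕ} (h : T.width r = 0) :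
    T.size = T.edgeCount r := by
  rw [size, edges_eq_edgesBelow fun s hs => width_eq_zero_of_le h hs.le,
    Set.encard_coe_eq_coe_finsetCard, card_edgesBelow]

theorem height_eq {T : PlanarTree} {r : ℕ} (h : T.width r ≠ 0) (h' : T.width (r + 1) = 0) :
    T.height = r := by
  refine IsGreatest.csSup_eq ⟨h, fun s hs => ?_⟩
  by_contra! hlt
  exact hs (width_eq_zero_of_le h' hlt)

theorem width_ball (T : PlanarTree) {r : ℕ} (hr : 1 ≤ r) (s : ℕ) :
    (T.ball r).width s = if s ≤ r then T.width s else 0 := by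
  cases s with
  | zero => rfl
  | succ s =>
    have h_iff : (s < r ∨ s = 0) ↔ s + 1 ≤ r := by omega
    simp only [width, ball, h_iff]
    split_ifs <;> rfl

theorem ballVolume_eq_edgeCount (T : PlanarTree) {r : ℕ} (hr : 1 ≤ r) :
    T.ballVolume r = T.edgeCount r := by
  have h_ball : ∀ s, r < s → (T.ball r).width s = 0 := fun s hs => by
    rw [width_ball T hr, if_neg hs.not_ge]
  rw [ballVolume, edges_eq_edgesBelow h_ball, Set.ncard_coe_finset, card_edgesBelow]
  refine Finset.sum_congr rfl fun s hs => ?_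
  rw [width_ball T hr, if_pos (Nat.succ_le_of_lt (Finset.mem_range.1 hs))]

theorem width_eq_of_mem_cylinder {T T' : PlanarTree} {r s : ℕ} (h : T' ∈ T.cylinder r)
    (hs : s ≤ r) : T'.width s = T.width s := by
  cases s with
  | zero => rfl
  | succ s => rw [width, width, h s hs]

theorem edgeCount_eq_of_mem_cylinder {T T' : PlanarTree} {r : ℕ} (h : T' ∈ T.cylinder r) :
    T'.edgeCount r = T.edgeCount r :=
  Finset.sum_congr rfl fun _ hi => width_eq_of_mem_cylinder h (Finset.mem_range.1 hi)

theorem edgeCount_extend (T : PlanarTree) (r : ℕ) (ℓ : Generation (T.width (r + 1))) :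
    (T.extend r ℓ).edgeCount (r + 2) = T.edgeCount (r + 1) + ℓ.length := by
  rw [edgeCount, Finset.sum_range_succ, extend_width]
  exact congrArg (· + _) (edgeCount_eq_of_mem_cylinder (extend_mem_cylinder T r ℓ))

theorem cylinder_eq_singleton {T : PlanarTree} {r : ℕ} (h : T.width r = 0) :
    T.cylinder r = {T} := by
  refine Set.eq_singleton_iff_unique_mem.2 ⟨self_mem_cylinder T r, fun T' hT => ?_⟩
  have h' : T'.width r = 0 := (width_eq_of_mem_cylinder hT le_rfl).trans h
  ext1
  funext s
  rcases lt_or_ge s r with hs | hs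
  · exact hT s hs
  · rw [List.eq_nil_of_length_eq_zero (width_eq_zero_of_le h (Nat.le_succ_of_le hs)),
      List.eq_nil_of_length_eq_zero (width_eq_zero_of_le h' (Nat.le_succ_of_le hs))]

/-! ### The weight of a cylinder -/

/-- The finite size measure before normalization. -/
noncomputable def weightMeasure (μ : ℝ) (N : ℕ) : Measure PlanarTree :=
  Measure.sum fun T : treesOfSize N => weight μ T • Measure.dirac T.1

section WeightMeasure

variable (μ : ℝ) (N : ℕ)

theorem weightMeasure_apply {A : Set PlanarTree} (hA : MeasurableSet A) :
    weightMeasure μ N A = ∑' T : treesOfSize N, weight μ T * A.indicator 1 T.1 := by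
  rw [weightMeasure, Measure.sum_apply _ hA]
  refine tsum_congr fun T => ?_
  rw [Measure.smul_apply, Measure.dirac_apply' _ hA, smul_eq_mul]

theorem weightMeasure_univ : weightMeasure μ N Set.univ = partitionFunction μ N := by
  rw [weightMeasure_apply μ N MeasurableSet.univ, partitionFunction]
  simp

theorem finiteSizeMeasure_eq_smul :
    finiteSizeMeasure μ N = (partitionFunction μ N)⁻¹ • weightMeasure μ N := by
  ext A hA
  rw [Measure.smul_apply, weightMeasure, finiteSizeMeasure, Measure.sum_apply _ hA,
    Measure.sum_apply _ hA, smul_eq_mul, ← ENNReal.tsum_mul_left]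
  refine tsum_congr fun T => ?_
  rw [Measure.smul_apply, Measure.smul_apply, smul_eq_mul, smul_eq_mul, div_eq_mul_inv,
    mul_comm (weight μ T), mul_assoc]

theorem finiteSizeMeasure_apply (A : Set PlanarTree) :
    finiteSizeMeasure μ N A = weightMeasure μ N A / partitionFunction μ N := by
  rw [finiteSizeMeasure_eq_smul, Measure.smul_apply, smul_eq_mul, mul_comm, div_eq_mul_inv]

theorem weightMeasure_singleton (T : PlanarTree) :
    weightMeasure μ N {T} = if T.size = N then weight μ T else 0 := by
  rw [weightMeasure_apply μ N (measurableSet_singleton T)]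
  split_ifs with h_size
  · rw [tsum_eq_single ⟨T, h_size⟩]
    · simp
    · intro T' hT'
      rw [Set.indicator_of_notMem, mul_zero]
      exact fun h => hT' (Subtype.ext h)
  · refine ENNReal.tsum_eq_zero.2 fun ⟨T', hT'⟩ => ?_
    rw [Set.indicator_of_notMem, mul_zero]
    rintro rfl
    exact h_size hT'

theorem weight_eq_pow (T : PlanarTree) :
    weight μ T = ENNReal.ofReal (Real.exp (-μ)) ^ T.height := by
  rw [weight, ← ENNReal.ofReal_pow (Real.exp_pos _).le, ← Real.exp_nat_mul, mul_comm]

variable {μ N}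

theorem weightMeasure_cylinder_of_lt {r : ℕ} {T : PlanarTree} (h : N < T.edgeCount r) :
    weightMeasure μ N (T.cylinder r) = 0 := by
  rw [weightMeasure_apply μ N (measurableSet_cylinder T r), ENNReal.tsum_eq_zero]
  rintro ⟨T', hT'⟩
  rw [Set.indicator_of_notMem, mul_zero]
  intro h_mem
  have h_le := edgeCount_le_size T' r
  rw [edgeCount_eq_of_mem_cylinder h_mem, show T'.size = N from hT', Nat.cast_le] at h_le
  omega

theorem weightMeasure_cylinder_extend_empty {r : ℕ} {T : PlanarTree} (h : T.width (r + 1) ≠ 0) :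
    weightMeasure μ N ((T.extend r (.empty _)).cylinder (r + 2)) =
      if T.edgeCount (r + 1) = N then ENNReal.ofReal (Real.exp (-μ)) ^ (r + 1) else 0 := by
  have h_width : (T.extend r (.empty _)).width (r + 2) = 0 := extend_width T r _
  have h_height : (T.extend r (.empty _)).height = r + 1 := by
    refine height_eq ?_ h_width
    rwa [width_eq_of_mem_cylinder (extend_mem_cylinder T r _) le_rfl]
  have h_size : (T.extend r (.empty _)).size = T.edgeCount (r + 1) := by
    rw [size_eq_edgeCount h_width, edgeCount_extend]
    rfl
  rw [cylinder_eq_singleton h_width, weightMeasure_singleton, h_size, weight_eq_pow, h_height]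
  simp only [Nat.cast_inj]

end WeightMeasure

theorem weightMeasure_cylinder (μ : ℝ) (N n : ℕ) : ∀ (T : PlanarTree) (r : ℕ),
    T.width (r + 1) ≠ 0 → T.edgeCount (r + 1) + n = N →
    weightMeasure μ N (T.cylinder (r + 1)) = ENNReal.ofReal (Real.exp (-μ)) ^ (r + 1) *
      extensionWeight (ENNReal.ofReal (Real.exp (-μ))) (T.width (r + 1)) n := by
  induction n using Nat.strong_induction_on with
  | _ n ih =>
  intro T r hw hN
  rw [measure_cylinder_eq_tsum, extensionWeight_eq_tsum _ hw, ← Generation.tsum_comp_length,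
    ← ENNReal.tsum_mul_left]
  refine tsum_congr fun ℓ => ?_
  rcases eq_or_ne ℓ.length 0 with h0 | h0
  · have h_iff : T.edgeCount (r + 1) = N ↔ n = 0 := by omega
    rw [if_pos h0, Generation.length_eq_zero.1 h0, weightMeasure_cylinder_extend_empty hw]
    simp only [h_iff, mul_ite, mul_one, mul_zero]
  rw [if_neg h0]
  split_ifs with hn
  · rw [ih (n - ℓ.length) (by omega) _ (r + 1) (by rwa [extend_width])
      (by rw [edgeCount_extend]; omega), extend_width, pow_succ, mul_assoc]
  · rw [mul_zero]
    exact weightMeasure_cylinder_of_lt (by rw [edgeCount_extend]; omega)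

/-! ### The law of the next generation -/

/-- The value at `K` of the harmonic function of the width process that describes the asymptotics
of `extensionWeight`, normalized to be `1` at `K = 1`. -/
noncomputable def harmonicWeight (b : ℝ) (K : ℕ) : ℝ := K * (1 + b) ^ (K - 1)

/-- The probability that a generation of `K` vertices is followed by a given generation of `L`
vertices: the Doob transform of the weights `b⁻¹ * koebe b ^ L` by `harmonicWeight`. -/
noncomputable def generationProb (b : ℝ) (K L : ℕ) : ℝ :=
  b⁻¹ * koebe b ^ L * harmonicWeight b L / harmonicWeight b K

section GenerationLaw

variable {b : ℝ}

@[simp]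
theorem harmonicWeight_zero (b : ℝ) : harmonicWeight b 0 = 0 := by simp [harmonicWeight]

@[simp]
theorem harmonicWeight_one (b : ℝ) : harmonicWeight b 1 = 1 := by simp [harmonicWeight]

theorem harmonicWeight_succ (b : ℝ) (k : ℕ) :
    harmonicWeight b (k + 1) = (k + 1) * (1 + b) ^ k := by simp [harmonicWeight]

theorem harmonicWeight_nonneg (hb : 0 < b) (K : ℕ) : 0 ≤ harmonicWeight b K := by
  unfold harmonicWeight; positivity

theorem harmonicWeight_pos (hb : 0 < b) {K : ℕ} (hK : K ≠ 0) : 0 < harmonicWeight b K := by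
  have := Nat.pos_of_ne_zero hK
  unfold harmonicWeight; positivity

theorem generationProb_nonneg (hb : 0 < b) (K L : ℕ) : 0 ≤ generationProb b K L :=
  div_nonneg (mul_nonneg (mul_nonneg (by positivity) (pow_nonneg (koebe_pos hb).le L))
    (harmonicWeight_nonneg hb L)) (harmonicWeight_nonneg hb K)

theorem koebe_mul_one_add_sq (hb : 0 < b) : koebe b * (1 + b) ^ 2 = b :=
  div_mul_cancel₀ _ (by positivity)

theorem hasSum_choose_mul_koebe_pow (hb : 0 < b) (k : ℕ) :
    HasSum (fun n => ((n + k).choose k : ℝ) * (koebe b * (1 + b)) ^ n) ((1 + b) ^ (k + 1)) := by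
  have h_eq : koebe b * (1 + b) = b / (1 + b) := by unfold koebe; field_simp
  have h_norm : ‖koebe b * (1 + b)‖ < 1 := by
    rw [h_eq, Real.norm_of_nonneg (by positivity), div_lt_one (by positivity)]
    linarith
  have h_inv : 1 / (1 - koebe b * (1 + b)) = 1 + b := by rw [h_eq]; field_simp; ring
  have h_sum := hasSum_choose_mul_geometric_of_norm_lt_one k h_norm
  rwa [← one_div_pow, h_inv] at h_sum

theorem multichoose_succ_succ_mul (k j : ℕ) : (k + 1).multichoose (j + 1) * (j + 1) =
    (k + 1) * (j + (k + 1)).choose (k + 1) := by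
  rw [Nat.multichoose_eq, show k + 1 + (j + 1) - 1 = k + j + 1 by omega,
    ← Nat.add_one_mul_choose_eq, show j + (k + 1) = k + j + 1 by omega, mul_comm (k + 1),
    ← Nat.add_one_mul_choose_eq, Nat.choose_symm_add]

theorem hasSum_multichoose_mul_harmonicWeight (hb : 0 < b) (K : ℕ) :
    HasSum (fun L => (K.multichoose L : ℝ) * (koebe b ^ L * harmonicWeight b L))
      (b * harmonicWeight b K) := by
  rw [← hasSum_nat_add_iff' 1, Finset.sum_range_one, harmonicWeight_zero, mul_zero, mul_zero,
    sub_zero]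
  cases K with
  | zero => simp
  | succ k =>
    have h_sum := (hasSum_choose_mul_koebe_pow hb (k + 1)).mul_left ((k + 1) * koebe b)
    have h_value : (k + 1) * koebe b * (1 + b) ^ (k + 1 + 1) = b * harmonicWeight b (k + 1) := by
      rw [harmonicWeight_succ]
      linear_combination ((k + 1) * (1 + b) ^ k) * koebe_mul_one_add_sq hb
    rw [h_value] at h_sum
    refine h_sum.congr_fun fun j => ?_
    have h_choose : ((k + 1).multichoose (j + 1) : ℝ) * (j + 1) =
        (k + 1) * (j + (k + 1)).choose (k + 1) := by
      exact_mod_cast multichoose_succ_succ_mul k j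
    rw [harmonicWeight_succ, mul_pow]
    linear_combination koebe b ^ (j + 1) * (1 + b) ^ j * h_choose

theorem hasSum_generationProb (hb : 0 < b) {K : ℕ} (hK : K ≠ 0) :
    HasSum (fun L => (K.multichoose L : ℝ) * generationProb b K L) 1 := by
  have h_pos := harmonicWeight_pos hb hK
  have h_sum := (hasSum_multichoose_mul_harmonicWeight hb K).mul_left
    (b⁻¹ / harmonicWeight b K)
  rw [show b⁻¹ / harmonicWeight b K * (b * harmonicWeight b K) = 1 by field_simp] at h_sum
  refine h_sum.congr_fun fun L => ?_
  rw [generationProb]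
  ring

/-- The weights `K * b ^ (K - 1)` are invariant under the width process. -/
theorem hasSum_mul_generationProb (hb : 0 < b) (L : ℕ) :
    HasSum (fun K : ℕ => K * b ^ (K - 1) * ((K.multichoose L : ℝ) * generationProb b K L))
      (L * b ^ (L - 1)) := by
  have h_sum := (hasSum_choose_mul_koebe_pow hb L).mul_left
    (b⁻¹ * koebe b ^ L * harmonicWeight b L)
  have h_value : b⁻¹ * koebe b ^ L * harmonicWeight b L * (1 + b) ^ (L + 1) =
      L * b ^ (L - 1) := by
    cases L with
    | zero => simp
    | succ j =>
      have h_pow : koebe b ^ (j + 1) * (1 + b) ^ (2 * (j + 1)) = b ^ (j + 1) := by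
        rw [pow_mul, ← mul_pow, koebe_mul_one_add_sq hb]
      calc b⁻¹ * koebe b ^ (j + 1) * harmonicWeight b (j + 1) * (1 + b) ^ (j + 1 + 1)
          = (j + 1) * b⁻¹ * (koebe b ^ (j + 1) * (1 + b) ^ (2 * (j + 1))) := by
            rw [harmonicWeight_succ]; ring
        _ = (j + 1 : ℕ) * b ^ (j + 1 - 1) := by
            rw [h_pow, Nat.add_sub_cancel, pow_succ]
            push_cast
            field_simp
  rw [h_value] at h_sum
  rw [← hasSum_nat_add_iff' 1, Finset.sum_range_one, Nat.cast_zero, zero_mul, zero_mul, sub_zero]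
  refine h_sum.congr_fun fun k => ?_
  have h_pow : b ^ k = (koebe b * (1 + b)) ^ k * (1 + b) ^ k := by
    rw [← mul_pow, mul_assoc, ← sq, koebe_mul_one_add_sq hb]
  rw [generationProb, harmonicWeight_succ, Nat.add_sub_cancel, Nat.multichoose_eq,
    show k + 1 + L - 1 = k + L by omega, h_pow]
  push_cast
  field_simp

theorem tsum_ofReal_generationProb (hb : 0 < b) {K : ℕ} (hK : K ≠ 0) :
    ∑' ℓ : Generation K, ENNReal.ofReal (generationProb b K ℓ.length) = 1 := by
  have h_sum := hasSum_generationProb hb hK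
  rw [Generation.tsum_comp_length K fun L => ENNReal.ofReal (generationProb b K L),
    ← ENNReal.ofReal_one, ← h_sum.tsum_eq, ENNReal.ofReal_tsum_of_nonneg
      (fun L => mul_nonneg (by positivity) (generationProb_nonneg hb K L)) h_sum.summable]
  refine tsum_congr fun L => ?_
  rw [ENNReal.ofReal_mul (by positivity), ENNReal.ofReal_natCast]

/-- The law of the generation following a generation of `K` vertices. -/
noncomputable def generationLaw (b : ℝ) (K : ℕ) : Measure (Generation K) :=
  if K = 0 then Measure.dirac (.empty K) else
    Measure.sum fun ℓ : Generation K =>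
      ENNReal.ofReal (generationProb b K ℓ.length) • Measure.dirac ℓ

theorem isProbabilityMeasure_generationLaw (hb : 0 < b) (K : ℕ) :
    IsProbabilityMeasure (generationLaw b K) := by
  rw [generationLaw]
  split_ifs with hK
  · infer_instance
  · constructor
    rw [Measure.sum_apply _ MeasurableSet.univ]
    simpa using tsum_ofReal_generationProb hb hK

theorem generationLaw_singleton (b : ℝ) {K : ℕ} (hK : K ≠ 0) (ℓ : Generation K) :
    generationLaw b K {ℓ} = ENNReal.ofReal (generationProb b K ℓ.length) := by
  rw [generationLaw, if_neg hK, Measure.sum_apply _ (MeasurableSet.singleton ℓ),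
    tsum_eq_single ℓ]
  · simp
  · intro ℓ' h
    simp [h]

end GenerationLaw

/-! ### The limit measure -/

/-- The parent lists of `buildTree u`. -/
def buildParents (u : (i : ℕ × ℕ) → Generation i.2) : ℕ → List ℕ
  | 0 => [0]
  | r + 1 => (u (r, (buildParents u r).length)).1

/-- The tree whose generation at height `r + 2` is `u (r, K)` if its width at height `r + 1`
is `K`. -/
def buildTree (u : (i : ℕ × ℕ) → Generation i.2) : PlanarTree where
  parents := buildParents u
  parents_zero := rfl
  parents_mono
    | 0 => List.pairwise_singleton _ _
    | _ + 1 => (u _).2.1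
  parents_lt r := (u (r, (buildParents u r).length)).2.2

instance : Inhabited PlanarTree := ⟨buildTree fun i => .empty i.2⟩

/-- The law of a tree whose generations are chosen successively according to `generationLaw`. -/
noncomputable def limitMeasure (b : ℝ) : Measure PlanarTree :=
  (Measure.infinitePi fun i : ℕ × ℕ => generationLaw b i.2).map buildTree

/-- The indices of the entries of `u` on which the first `r + 1` levels of `buildTree u` depend
when they agree with those of `T`. -/
def generationIndices (T : PlanarTree) (r : ℕ) : Finset (ℕ × ℕ) :=
  (Finset.range r).map ⟨fun s => (s, T.width (s + 1)), fun _ _ h => congrArg Prod.fst h⟩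

theorem buildTree_preimage_cylinder (T : PlanarTree) (r : ℕ) :
    buildTree ⁻¹' T.cylinder (r + 1) = Set.pi (T.generationIndices r) fun i : ℕ × ℕ =>
      {ℓ : Generation i.2 | ℓ.1 = T.parents (i.1 + 1)} := by
  ext u
  simp only [Set.mem_preimage, Set.mem_pi, generationIndices, Finset.coe_map, Set.forall_mem_image,
    Finset.coe_range, Set.mem_Iio]
  have h_step : ∀ s, buildParents u s = T.parents s →
      (buildParents u (s + 1) = T.parents (s + 1) ↔
        (u (s, T.width (s + 1))).1 = T.parents (s + 1)) := fun s hs => by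
    rw [buildParents, hs]
    rfl
  constructor
  · exact fun h s hs => (h_step s (h s (by omega))).1 (h (s + 1) (by omega))
  · intro h s
    induction s with
    | zero => exact fun _ => T.parents_zero.symm
    | succ s ih => exact fun hs => (h_step s (ih (by omega))).2 (h (by omega))

theorem measurable_buildTree : Measurable buildTree := by
  refine Measurable.mono (measurable_generateFrom ?_) le_rfl eq_generateFrom_cylinders.le
  rintro _ ⟨T, r, rfl⟩
  rw [buildTree_preimage_cylinder]
  exact MeasurableSet.pi (Finset.countable_toSet _) fun i _ => MeasurableSet.of_discrete

section LimitMeasure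

variable {b : ℝ}

theorem isProbabilityMeasure_limitMeasure (hb : 0 < b) :
    IsProbabilityMeasure (limitMeasure b) := by
  have := fun i : ℕ × ℕ => isProbabilityMeasure_generationLaw hb i.2
  exact Measure.isProbabilityMeasure_map measurable_buildTree.aemeasurable

theorem limitMeasure_cylinder_eq_prod (hb : 0 < b) (T : PlanarTree) (r : ℕ) :
    limitMeasure b (T.cylinder (r + 1)) =
      ∏ s ∈ Finset.range r, generationLaw b (T.width (s + 1)) {T.generation s} := by
  have := fun i : ℕ × ℕ => isProbabilityMeasure_generationLaw hb i.2
  rw [limitMeasure, Measure.map_apply measurable_buildTree (measurableSet_cylinder T _),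
    buildTree_preimage_cylinder, Measure.infinitePi_pi _ fun i _ => MeasurableSet.of_discrete,
    generationIndices, Finset.prod_map]
  refine Finset.prod_congr rfl fun s _ => congrArg _ (Set.ext fun ℓ => ?_)
  exact ⟨fun h => Subtype.ext h, fun h => congrArg Subtype.val h⟩

theorem width_one (T : PlanarTree) : T.width 1 = 1 := by
  rw [width, T.parents_zero]; rfl

theorem edgeCount_one (T : PlanarTree) : T.edgeCount 1 = 1 := by
  simp [edgeCount, width_one]

theorem limitMeasure_cylinder (hb : 0 < b) (T : PlanarTree) (r : ℕ) :
    limitMeasure b (T.cylinder (r + 1)) = ENNReal.ofReal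
      (b⁻¹ ^ r * koebe b ^ T.edgeCount (r + 1) * harmonicWeight b (T.width (r + 1)) /
        koebe b) := by
  have hκ := koebe_pos hb
  induction r with
  | zero =>
    have := isProbabilityMeasure_limitMeasure hb
    simp [cylinder_one, width_one, edgeCount_one, hκ.ne']
  | succ r ih =>
    rw [limitMeasure_cylinder_eq_prod hb, Finset.prod_range_succ,
      ← limitMeasure_cylinder_eq_prod hb, ih]
    rcases eq_or_ne (T.width (r + 1)) 0 with hw | hw
    · simp [hw, width_succ_eq_zero hw]
    · have h_ne := (harmonicWeight_pos hb hw).ne'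
      have h_nonneg := harmonicWeight_nonneg hb (T.width (r + 1))
      rw [generationLaw_singleton b hw, ← ENNReal.ofReal_mul (by positivity),
        generation_length, generationProb,
        show T.edgeCount (r + 1 + 1) = T.edgeCount (r + 1) + T.width (r + 2) from
          Finset.sum_range_succ _ _]
      congr 1
      rw [pow_succ b⁻¹, pow_add (koebe b)]
      field_simp

theorem limitMeasure_cylinder_of_width_eq_zero (hb : 0 < b) {T : PlanarTree} {r : ℕ}
    (hw : T.width (r + 1) = 0) : limitMeasure b (T.cylinder (r + 1)) = 0 := by
  simp [limitMeasure_cylinder hb, hw]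

end LimitMeasure

/-! ### Weak convergence -/

section LocalLimit

theorem extensionWeight_one_ne_zero {a : ℝ≥0∞} (ha : a ≠ 0) (n : ℕ) :
    extensionWeight a 1 n ≠ 0 := by
  induction n with
  | zero => rw [extensionWeight_eq]; simp
  | succ n ih =>
    have h_mem : (1, n) ∈ Finset.HasAntidiagonal.antidiagonal (n + 1) :=
      Finset.HasAntidiagonal.mem_antidiagonal.2 (add_comm 1 n)
    rw [extensionWeight_eq]
    intro h
    have h_sum := (mul_eq_zero.1 (add_eq_zero.1 h).2).resolve_left ha
    have h_term := Finset.sum_eq_zero_iff.1 h_sum _ h_mem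
    simp [ih] at h_term

theorem tendsto_extensionWeight_div {b : ℝ} (hb : 0 < b) (hb1 : b < 1) (K v : ℕ) :
    Tendsto (fun n => extensionWeight (ENNReal.ofReal b⁻¹) K n /
      extensionWeight (ENNReal.ofReal b⁻¹) 1 (n + v)) atTop
      (𝓝 (ENNReal.ofReal (harmonicWeight b K * koebe b ^ v))) := by
  have hκ := koebe_pos hb
  have h_pole := poleConst_pos hb hb1
  have h_ne_zero := extensionWeight_one_ne_zero (ENNReal.ofReal_pos.2 (inv_pos.2 hb)).ne'
  have h_ne_top : ∀ n, extensionWeight (ENNReal.ofReal b⁻¹) K n /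
      extensionWeight (ENNReal.ofReal b⁻¹) 1 (n + v) ≠ ∞ := fun n =>
    ENNReal.div_ne_top (extensionWeight_ne_top hb hb1 K n) (h_ne_zero _)
  rw [← ENNReal.tendsto_toReal_iff h_ne_top ENNReal.ofReal_ne_top, ENNReal.toReal_ofReal
    (mul_nonneg (harmonicWeight_nonneg hb K) (by positivity))]
  have h_limit : K * (1 + b) ^ K * poleConst b / ((1 : ℕ) * (1 + b) ^ 1 * poleConst b) =
      harmonicWeight b K := by
    cases K with
    | zero => simp
    | succ k =>
      rw [harmonicWeight_succ, pow_succ]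
      push_cast
      field_simp
  have h_tendsto := ((tendsto_extensionWeight hb hb1 K).div
    ((tendsto_extensionWeight hb hb1 1).comp (tendsto_add_atTop_nat v))
    (by positivity)).mul_const (koebe b ^ v)
  rw [h_limit] at h_tendsto
  refine h_tendsto.congr fun n => ?_
  have := ENNReal.toReal_ne_zero.2
    ⟨h_ne_zero (n + v), extensionWeight_ne_top hb hb1 1 (n + v)⟩
  simp only [Function.comp_apply, Pi.div_apply]
  rw [ENNReal.toReal_div, add_right_comm n v 1, pow_add _ (n + 1) v]
  field_simp

variable {μ : ℝ}

theorem partitionFunction_succ (μ : ℝ) (N : ℕ) : partitionFunction μ (N + 1) =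
    ENNReal.ofReal (Real.exp (-μ)) * extensionWeight (ENNReal.ofReal (Real.exp (-μ))) 1 N := by
  have h := weightMeasure_cylinder μ (N + 1) N default 0 (by simp [width_one])
    (by rw [zero_add, edgeCount_one, add_comm])
  rwa [zero_add, cylinder_one, weightMeasure_univ, width_one, pow_one] at h

theorem extensionWeight_exp_ne_top (hμ : μ < 0) (K n : ℕ) :
    extensionWeight (ENNReal.ofReal (Real.exp (-μ))) K n ≠ ∞ := by
  rw [Real.exp_neg]
  exact extensionWeight_ne_top (Real.exp_pos μ) (Real.exp_lt_one_iff.2 hμ) K n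

theorem isProbabilityMeasure_finiteSizeMeasure (hμ : μ < 0) (N : ℕ) :
    IsProbabilityMeasure (finiteSizeMeasure μ (N + 1)) := by
  have h_exp := (ENNReal.ofReal_pos.2 (Real.exp_pos (-μ))).ne'
  constructor
  rw [finiteSizeMeasure_apply, weightMeasure_univ, partitionFunction_succ]
  exact ENNReal.div_self (mul_ne_zero h_exp (extensionWeight_one_ne_zero h_exp N))
    (ENNReal.mul_ne_top ENNReal.ofReal_ne_top (extensionWeight_exp_ne_top hμ 1 N))

theorem finiteSizeMeasure_cylinder (μ : ℝ) {N n r : ℕ} {T : PlanarTree}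
    (hw : T.width (r + 1) ≠ 0) (hN : T.edgeCount (r + 1) + n = N + 1) :
    finiteSizeMeasure μ (N + 1) (T.cylinder (r + 1)) = ENNReal.ofReal (Real.exp (-μ)) ^ r *
      (extensionWeight (ENNReal.ofReal (Real.exp (-μ))) (T.width (r + 1)) n /
        extensionWeight (ENNReal.ofReal (Real.exp (-μ))) 1 N) := by
  rw [finiteSizeMeasure_apply, partitionFunction_succ, weightMeasure_cylinder μ _ n T r hw hN,
    pow_succ', mul_assoc, ENNReal.mul_div_mul_left _ _ (ENNReal.ofReal_pos.2 (Real.exp_pos _)).ne'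
      ENNReal.ofReal_ne_top, mul_div_assoc]

theorem finiteSizeMeasure_cylinder_of_width_eq_zero (μ : ℝ) {N r : ℕ} {T : PlanarTree}
    (hw : T.width r = 0) (hN : T.edgeCount r ≠ N) :
    finiteSizeMeasure μ N (T.cylinder r) = 0 := by
  rw [finiteSizeMeasure_apply, cylinder_eq_singleton hw, weightMeasure_singleton,
    size_eq_edgeCount hw, if_neg (by rwa [Nat.cast_inj]), ENNReal.zero_div]

theorem tendsto_finiteSizeMeasure_cylinder (hμ : μ < 0) (T : PlanarTree) (r : ℕ) :
    Tendsto (fun N => finiteSizeMeasure μ (N + 1) (T.cylinder (r + 1))) atTop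
      (𝓝 (limitMeasure (Real.exp μ) (T.cylinder (r + 1)))) := by
  have hb := Real.exp_pos μ
  rcases eq_or_ne (T.width (r + 1)) 0 with hw | hw
  · rw [limitMeasure_cylinder_of_width_eq_zero hb hw]
    refine tendsto_const_nhds.congr' ?_
    filter_upwards [eventually_ge_atTop (T.edgeCount (r + 1))] with N hN
    exact (finiteSizeMeasure_cylinder_of_width_eq_zero μ hw (by omega)).symm
  obtain ⟨v, hv⟩ : ∃ v, T.edgeCount (r + 1) = v + 1 := by
    refine Nat.exists_eq_add_one.2 ?_
    calc 0 < T.edgeCount 1 := by simp [edgeCount_one]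
      _ ≤ T.edgeCount (r + 1) := Finset.sum_le_sum_of_subset (Finset.range_mono (by omega))
  have h_limit : limitMeasure (Real.exp μ) (T.cylinder (r + 1)) =
      ENNReal.ofReal (Real.exp μ)⁻¹ ^ r * ENNReal.ofReal
        (harmonicWeight (Real.exp μ) (T.width (r + 1)) * koebe (Real.exp μ) ^ v) := by
    have hκ := koebe_pos hb
    rw [limitMeasure_cylinder hb, hv, ← ENNReal.ofReal_pow (by positivity),
      ← ENNReal.ofReal_mul (by positivity), pow_succ (koebe _)]
    congr 1
    field_simp
  rw [h_limit, ← tendsto_add_atTop_iff_nat v]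
  refine (ENNReal.Tendsto.const_mul (tendsto_extensionWeight_div hb (Real.exp_lt_one_iff.2 hμ) _ v)
    (Or.inr (ENNReal.pow_ne_top ENNReal.ofReal_ne_top))).congr fun n => ?_
  rw [finiteSizeMeasure_cylinder μ hw (n := n) (by omega), Real.exp_neg]

theorem isLocalLimit_limitMeasure (hμ : μ < 0) :
    IsLocalLimit μ (limitMeasure (Real.exp μ)) := by
  have h_limit := isProbabilityMeasure_limitMeasure (Real.exp_pos μ)
  have h_finite := isProbabilityMeasure_finiteSizeMeasure hμ
  refine ⟨h_limit, fun F => ?_⟩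
  rw [← tendsto_add_atTop_iff_nat 1]
  have h_tendsto : Tendsto (β := ProbabilityMeasure PlanarTree)
      (fun N => ⟨finiteSizeMeasure μ (N + 1), h_finite N⟩) atTop
      (𝓝 ⟨limitMeasure (Real.exp μ), h_limit⟩) := by
    refine isPiSystem_cylinders.tendsto_probabilityMeasure_of_tendsto_of_mem ?_ ?_ ?_
    · rintro _ ⟨T, r, rfl⟩
      exact measurableSet_cylinder T _
    · intro U hU T hT
      obtain ⟨r, hr⟩ := exists_cylinder_subset hU hT
      exact ⟨_, ⟨T, r, rfl⟩, cylinder_mem_nhds T _, hr⟩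
    · rintro _ ⟨T, r, rfl⟩
      exact (ENNReal.tendsto_toNNReal (measure_ne_top (limitMeasure (Real.exp μ)) _)).comp
        (tendsto_finiteSizeMeasure_cylinder hμ T r)
  exact ProbabilityMeasure.tendsto_iff_forall_integral_tendsto.1 h_tendsto F

end LocalLimit

/-! ### The law of the width -/

theorem measure_eq_tsum_cylinder_inter (ν : Measure PlanarTree) (r : ℕ) (A : Set PlanarTree) :
    ν A = ∑' c : Set.range fun T : PlanarTree => T.cylinder r, ν (c.1 ∩ A) := by
  have h_fiber (T : PlanarTree) :
      (fun T' : PlanarTree => T'.cylinder r) ⁻¹' {T.cylinder r} = T.cylinder r :=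
    Set.ext fun T' => ⟨fun h => (h : T'.cylinder r = T.cylinder r) ▸ self_mem_cylinder T' r,
      cylinder_eq_of_mem⟩
  have h_sum := tsum_measure_preimage_singleton (μ := ν.restrict A) (countable_range_cylinder r)
    (f := fun T : PlanarTree => T.cylinder r) (by
      rintro _ ⟨T, rfl⟩
      rw [h_fiber]
      exact measurableSet_cylinder T r)
  rw [Set.preimage_range, Measure.restrict_apply_univ] at h_sum
  rw [← h_sum]
  refine tsum_congr ?_
  rintro ⟨_, T, rfl⟩
  rw [h_fiber, Measure.restrict_apply (measurableSet_cylinder T r)]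

theorem cylinder_inter_width_eq {T : PlanarTree} {r L : ℕ} (h : T.width r = L) :
    T.cylinder r ∩ {T' | T'.width r = L} = T.cylinder r :=
  Set.inter_eq_left.2 fun _ hT' => (width_eq_of_mem_cylinder hT' le_rfl).trans h

theorem cylinder_inter_width_ne {T : PlanarTree} {r L : ℕ} (h : T.width r ≠ L) :
    T.cylinder r ∩ {T' | T'.width r = L} = ∅ :=
  Set.eq_empty_of_forall_notMem fun _ hT' =>
    h ((width_eq_of_mem_cylinder hT'.1 le_rfl).symm.trans hT'.2)

section WidthLaw

variable {b : ℝ}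

theorem limitMeasure_cylinder_extend (hb : 0 < b) (T : PlanarTree) (r : ℕ)
    (ℓ : Generation (T.width (r + 1))) :
    limitMeasure b ((T.extend r ℓ).cylinder (r + 2)) = limitMeasure b (T.cylinder (r + 1)) *
      ENNReal.ofReal (generationProb b (T.width (r + 1)) ℓ.length) := by
  rcases eq_or_ne (T.width (r + 1)) 0 with hw | hw
  · have h_null := limitMeasure_cylinder_of_width_eq_zero hb hw
    rw [h_null, zero_mul]
    exact measure_mono_null (fun _ h => (mem_cylinder_extend.1 h).1) h_null
  · have hκ := koebe_pos hb
    have h_ne := (harmonicWeight_pos hb hw).ne'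
    have h_nonneg := harmonicWeight_nonneg hb (T.width (r + 1))
    rw [limitMeasure_cylinder hb, limitMeasure_cylinder hb, ← ENNReal.ofReal_mul (by positivity),
      edgeCount_extend, extend_width, generationProb, pow_succ b⁻¹, pow_add (koebe b)]
    congr 1
    field_simp

theorem limitMeasure_cylinder_inter_width (hb : 0 < b) (T : PlanarTree) (r L : ℕ) :
    limitMeasure b (T.cylinder (r + 1) ∩ {T' | T'.width (r + 2) = L}) =
      limitMeasure b (T.cylinder (r + 1)) * ((T.width (r + 1)).multichoose L *
        ENNReal.ofReal (generationProb b (T.width (r + 1)) L)) := by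
  rw [← Measure.restrict_apply (measurableSet_cylinder T _), measure_cylinder_eq_tsum]
  have h_term (ℓ : Generation (T.width (r + 1))) :
      (limitMeasure b).restrict {T' | T'.width (r + 2) = L} ((T.extend r ℓ).cylinder (r + 2)) =
        if ℓ.length = L then limitMeasure b (T.cylinder (r + 1)) *
          ENNReal.ofReal (generationProb b (T.width (r + 1)) ℓ.length) else 0 := by
    rw [Measure.restrict_apply (measurableSet_cylinder _ _)]
    split_ifs with h
    · rw [cylinder_inter_width_eq ((extend_width T r ℓ).trans h),
        limitMeasure_cylinder_extend hb]
    · rw [cylinder_inter_width_ne (by rwa [extend_width]), measure_empty]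
  rw [tsum_congr h_term, Generation.tsum_comp_length _ fun L' => if L' = L then
    limitMeasure b (T.cylinder (r + 1)) *
      ENNReal.ofReal (generationProb b (T.width (r + 1)) L') else 0,
    tsum_eq_single L fun L' hL' => by rw [if_neg hL', mul_zero], if_pos rfl, mul_left_comm]

theorem limitMeasure_width_inter (hb : 0 < b) (r K L : ℕ) :
    limitMeasure b ({T | T.width (r + 1) = K} ∩ {T | T.width (r + 2) = L}) =
      limitMeasure b {T | T.width (r + 1) = K} *
        (K.multichoose L * ENNReal.ofReal (generationProb b K L)) := by
  rw [measure_eq_tsum_cylinder_inter _ (r + 1),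
    measure_eq_tsum_cylinder_inter _ (r + 1) {T | T.width (r + 1) = K}, ← ENNReal.tsum_mul_right]
  refine tsum_congr ?_
  rintro ⟨_, T, rfl⟩
  beta_reduce
  rw [← Set.inter_assoc]
  rcases eq_or_ne (T.width (r + 1)) K with h | h
  · rw [cylinder_inter_width_eq h, limitMeasure_cylinder_inter_width hb, h]
  · rw [cylinder_inter_width_ne h, Set.empty_inter, measure_empty, zero_mul]

theorem limitMeasure_width_eq_zero (hb : 0 < b) (r : ℕ) :
    limitMeasure b {T | T.width r = 0} = 0 := by
  cases r with
  | zero => simp [width]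
  | succ r =>
    exact measure_null_of_locally_null _ fun T hT =>
      ⟨_, mem_nhdsWithin_of_mem_nhds (cylinder_mem_nhds T _),
        limitMeasure_cylinder_of_width_eq_zero hb hT⟩

theorem ae_width_ne_zero (hb : 0 < b) : ∀ᵐ T ∂limitMeasure b, ∀ r, T.width r ≠ 0 :=
  ae_all_iff.2 fun r => ae_iff.2 (by simpa using limitMeasure_width_eq_zero hb r)

/-- The bound holds at height `1` and is propagated since its right hand side is invariant. -/
theorem limitMeasure_width_le (hb : 0 < b) (r L : ℕ) :
    limitMeasure b {T | T.width (r + 1) = L} ≤ ENNReal.ofReal (L * b ^ (L - 1)) := by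
  induction r generalizing L with
  | zero =>
    have := isProbabilityMeasure_limitMeasure hb
    simp only [zero_add, width_one]
    rcases eq_or_ne 1 L with rfl | hL
    · simp
    · simp [hL]
  | succ r ih =>
    have h_sum := hasSum_mul_generationProb hb L
    have h_nonneg (K : ℕ) : 0 ≤ K.multichoose L * generationProb b K L :=
      mul_nonneg (by positivity) (generationProb_nonneg hb K L)
    have h_cover : {T : PlanarTree | T.width (r + 2) = L} ⊆
        ⋃ K, {T | T.width (r + 1) = K} ∩ {T | T.width (r + 2) = L} := fun T hT =>
      Set.mem_iUnion.2 ⟨_, rfl, hT⟩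
    calc limitMeasure b {T | T.width (r + 2) = L}
        ≤ ∑' K, limitMeasure b ({T | T.width (r + 1) = K} ∩ {T | T.width (r + 2) = L}) :=
          (measure_mono h_cover).trans (measure_iUnion_le _)
      _ ≤ ∑' K : ℕ, ENNReal.ofReal
            (K * b ^ (K - 1) * (K.multichoose L * generationProb b K L)) := by
          refine ENNReal.tsum_le_tsum fun K => ?_
          rw [limitMeasure_width_inter hb, ENNReal.ofReal_mul (by positivity),
            ENNReal.ofReal_mul (p := (K.multichoose L : ℝ)) (by positivity),
            ENNReal.ofReal_natCast]
          exact mul_le_mul_left (ih K) _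
      _ = ENNReal.ofReal (L * b ^ (L - 1)) := by
          rw [← h_sum.tsum_eq, ENNReal.ofReal_tsum_of_nonneg
            (fun K => mul_nonneg (by positivity) (h_nonneg K)) h_sum.summable]

end WidthLaw

theorem natCast_mul_sq_pow_le {s : ℝ} (hs0 : 0 < s) (hs1 : s < 1) {m L : ℕ} (hm : m ≤ L) :
    L * (s ^ 2) ^ (L - 1) ≤ L * s ^ L * (s ^ m / s ^ 2) := by
  cases L with
  | zero => simp
  | succ j =>
    rw [Nat.add_sub_cancel, mul_assoc, ← mul_div_assoc]
    refine mul_le_mul_of_nonneg_left ((le_div_iff₀ (by positivity)).2 ?_) (by positivity)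
    rw [← pow_mul, ← pow_add, ← pow_add]
    exact pow_le_pow_of_le_one hs0.le hs1.le (by omega)

theorem exists_limitMeasure_le_width_le {s : ℝ} (hs0 : 0 < s) (hs1 : s < 1) :
    ∃ B : ℝ, 0 ≤ B ∧ ∀ r m : ℕ,
      limitMeasure (s ^ 2) {T | m ≤ T.width (r + 1)} ≤ ENNReal.ofReal (B * s ^ m) := by
  have h_summable : Summable fun L : ℕ => (L : ℝ) * s ^ L := by
    simpa using summable_pow_mul_geometric_of_norm_lt_one 1
      (by rwa [Real.norm_of_nonneg hs0.le] : ‖s‖ < 1)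
  refine ⟨(∑' L : ℕ, (L : ℝ) * s ^ L) / s ^ 2, by positivity, fun r m => ?_⟩
  have h_cover : {T : PlanarTree | m ≤ T.width (r + 1)} ⊆
      ⋃ L : ℕ, {T | m ≤ L ∧ T.width (r + 1) = L} := fun T hT =>
    Set.mem_iUnion.2 ⟨T.width (r + 1), hT, rfl⟩
  calc limitMeasure (s ^ 2) {T | m ≤ T.width (r + 1)}
      ≤ ∑' L, limitMeasure (s ^ 2) {T | m ≤ L ∧ T.width (r + 1) = L} :=
        (measure_mono h_cover).trans (measure_iUnion_le _)
    _ ≤ ∑' L : ℕ, ENNReal.ofReal (L * s ^ L * (s ^ m / s ^ 2)) := by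
        refine ENNReal.tsum_le_tsum fun L => ?_
        by_cases hm : m ≤ L
        · simp only [hm, true_and]
          exact (limitMeasure_width_le (by positivity) r L).trans
            (ENNReal.ofReal_le_ofReal (natCast_mul_sq_pow_le hs0 hs1 hm))
        · simp [hm]
    _ = ENNReal.ofReal ((∑' L : ℕ, (L : ℝ) * s ^ L) / s ^ 2 * s ^ m) := by
        rw [← ENNReal.ofReal_tsum_of_nonneg (fun L => by positivity) (h_summable.mul_right _),
          tsum_mul_right, mul_div_assoc', div_mul_eq_mul_div]

/-! ### Almost sure growth -/

theorem pow_ceil_log_le {s : ℝ} (hs0 : 0 < s) (hs1 : s < 1) {x : ℝ} (hx : 0 < x) :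
    s ^ ⌈2 / -Real.log s * Real.log x⌉₊ ≤ 1 / x ^ 2 := by
  have h_log := (Real.log_neg hs0 hs1).ne
  calc s ^ ⌈2 / -Real.log s * Real.log x⌉₊ ≤ s ^ (2 / -Real.log s * Real.log x) := by
        rw [← Real.rpow_natCast]
        exact Real.rpow_le_rpow_of_exponent_ge hs0 hs1.le (Nat.le_ceil _)
    _ = Real.exp (-(2 * Real.log x)) := by
        rw [Real.rpow_def_of_pos hs0]
        congr 1
        field_simp
    _ = 1 / x ^ 2 := by
        rw [Real.exp_neg, two_mul, Real.exp_add, Real.exp_log hx, sq, one_div]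

theorem exists_limitMeasure_log_lt_width_le {b : ℝ} (hb : 0 < b) (hb1 : b < 1) :
    ∃ C B : ℝ, 0 < C ∧ ∀ r : ℕ, limitMeasure b {T | C * Real.log (r + 1 : ℕ) < T.width (r + 1)} ≤
      ENNReal.ofReal (B * (1 / ((r + 1 : ℕ) : ℝ) ^ 2)) := by
  have hs0 : 0 < √b := Real.sqrt_pos.2 hb
  have hs1 : √b < 1 := (Real.sqrt_lt' one_pos).2 (by rwa [one_pow])
  obtain ⟨B, hB, h_tail⟩ := exists_limitMeasure_le_width_le hs0 hs1
  rw [Real.sq_sqrt hb.le] at h_tail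
  refine ⟨2 / -Real.log √b, B, div_pos two_pos (neg_pos.2 (Real.log_neg hs0 hs1)), fun r => ?_⟩
  have h_subset : {T : PlanarTree | 2 / -Real.log √b * Real.log (r + 1 : ℕ) < T.width (r + 1)} ⊆
      {T : PlanarTree | ⌈2 / -Real.log √b * Real.log (r + 1 : ℕ)⌉₊ ≤ T.width (r + 1)} :=
    fun T hT => Nat.ceil_le.2 (le_of_lt hT)
  refine (measure_mono h_subset).trans ((h_tail r _).trans (ENNReal.ofReal_le_ofReal ?_))
  exact mul_le_mul_of_nonneg_left (pow_ceil_log_le hs0 hs1 (by positivity)) hB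

theorem ae_eventually_width_le {b : ℝ} (hb : 0 < b) (hb1 : b < 1) :
    ∃ C : ℝ, 0 < C ∧ ∀ᵐ T ∂limitMeasure b, ∀ᶠ r : ℕ in atTop, T.width r ≤ C * Real.log r := by
  obtain ⟨C, B, hC, h_tail⟩ := exists_limitMeasure_log_lt_width_le hb hb1
  have h_summable : Summable fun r : ℕ => B * (1 / ((r + 1 : ℕ) : ℝ) ^ 2) :=
    ((summable_nat_add_iff 1).2 (Real.summable_one_div_nat_pow.2 one_lt_two)).mul_left B
  have h_borel_cantelli := ae_eventually_notMem
    (ne_top_of_le_ne_top h_summable.tsum_ofReal_ne_top (ENNReal.tsum_le_tsum h_tail))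
  refine ⟨C, hC, ?_⟩
  filter_upwards [h_borel_cantelli] with T hT
  rw [← map_add_atTop_eq_nat 1, eventually_map]
  exact hT.mono fun r hr => not_lt.1 hr

theorem le_edgeCount {T : PlanarTree} (h : ∀ r, T.width r ≠ 0) (r : ℕ) : r ≤ T.edgeCount r := by
  calc r = ∑ _s ∈ Finset.range r, 1 := by simp
    _ ≤ T.edgeCount r := Finset.sum_le_sum fun s _ => Nat.one_le_iff_ne_zero.2 (h _)

theorem edgeCount_le_of_width_le {T : PlanarTree} {C : ℝ} (hC : 0 ≤ C) {R : ℕ}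
    (h : ∀ r, R ≤ r → T.width r ≤ C * Real.log r) {r : ℕ} (hr : R ≤ r) :
    T.edgeCount r ≤ T.edgeCount R + r * (C * Real.log r) := by
  have h_width : ∀ s ∈ Finset.Ico R r, (T.width (s + 1) : ℝ) ≤ C * Real.log r := fun s hs => by
    obtain ⟨hRs, hsr⟩ := Finset.mem_Ico.1 hs
    refine (h (s + 1) (by omega)).trans (mul_le_mul_of_nonneg_left ?_ hC)
    exact Real.log_le_log (by positivity) (by exact_mod_cast hsr)
  have := Real.log_natCast_nonneg r
  calc (T.edgeCount r : ℝ)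
      = T.edgeCount R + ∑ s ∈ Finset.Ico R r, (T.width (s + 1) : ℝ) := by
        exact_mod_cast (Finset.sum_range_add_sum_Ico (fun s => T.width (s + 1)) hr).symm
    _ ≤ T.edgeCount R + (r - R : ℕ) * (C * Real.log r) := by
        gcongr
        simpa using Finset.sum_le_sum h_width
    _ ≤ T.edgeCount R + r * (C * Real.log r) := by
        gcongr
        exact Nat.sub_le r R

theorem one_le_log {r : ℕ} (hr : 3 ≤ r) : 1 ≤ Real.log r := by
  have h_three : (3 : ℝ) ≤ r := by exact_mod_cast hr
  rw [Real.le_log_iff_exp_le (by linarith)]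
  exact Real.exp_one_lt_three.le.trans h_three

theorem exists_growth_bounds {T : PlanarTree} (h_ne : ∀ r, T.width r ≠ 0) {C : ℝ} (hC : 0 ≤ C)
    (h : ∀ᶠ r : ℕ in atTop, T.width r ≤ C * Real.log r) :
    ∃ r₀ : ℕ, ∀ r : ℕ, r₀ ≤ r →
      (1 ≤ T.width r ∧ (T.width r : ℝ) ≤ C * Real.log r) ∧
      (r ≤ T.ballVolume r ∧ (T.ballVolume r : ℝ) ≤ (C + 1) * (r * Real.log r)) := by
  obtain ⟨R, hR⟩ := eventually_atTop.1 h
  refine ⟨max (max R 3) (T.edgeCount R), fun r hr => ?_⟩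
  obtain ⟨⟨hRr, hr3⟩, h_edges⟩ : (R ≤ r ∧ 3 ≤ r) ∧ T.edgeCount R ≤ r := by
    simpa only [max_le_iff] using hr
  refine ⟨⟨Nat.one_le_iff_ne_zero.2 (h_ne r), hR r hRr⟩, ?_⟩
  rw [ballVolume_eq_edgeCount T (by omega)]
  refine ⟨le_edgeCount h_ne r, ?_⟩
  calc (T.edgeCount r : ℝ) ≤ T.edgeCount R + r * (C * Real.log r) :=
        edgeCount_le_of_width_le hC hR hRr
    _ ≤ r * Real.log r + r * (C * Real.log r) := by
        gcongr
        exact (Nat.cast_le.2 h_edges).trans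
          (le_mul_of_one_le_right (Nat.cast_nonneg r) (one_le_log hr3))
    _ = (C + 1) * (r * Real.log r) := by ring

theorem tendsto_log_div_log_of_le {f : ℕ → ℝ} {C : ℝ} (hC : 0 < C)
    (h_lower : ∀ᶠ r : ℕ in atTop, (r : ℝ) ≤ f r)
    (h_upper : ∀ᶠ r : ℕ in atTop, f r ≤ C * (r * Real.log r)) :
    Tendsto (fun r : ℕ => Real.log (f r) / Real.log r) atTop (𝓝 1) := by
  have h_log : Tendsto (fun r : ℕ => Real.log r) atTop atTop :=
    Real.tendsto_log_atTop.comp tendsto_natCast_atTop_atTop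
  have h_const : Tendsto (fun r : ℕ => Real.log C / Real.log r) atTop (𝓝 0) :=
    h_log.const_div_atTop _
  have h_loglog : Tendsto (fun r : ℕ => Real.log (Real.log r) / Real.log r) atTop (𝓝 0) :=
    Real.isLittleO_log_id_atTop.tendsto_div_nhds_zero.comp h_log
  have h_limit := (h_const.add_const 1).add h_loglog
  rw [zero_add, add_zero] at h_limit
  refine tendsto_of_tendsto_of_tendsto_of_le_of_le' tendsto_const_nhds h_limit ?_ ?_
  · filter_upwards [h_lower, eventually_ge_atTop 3] with r hf hr
    have h_pos : (0 : ℝ) < r := by exact_mod_cast (show 0 < r by omega)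
    rw [le_div_iff₀ (one_pos.trans_le (one_le_log hr)), one_mul]
    exact Real.log_le_log h_pos hf
  · filter_upwards [h_lower, h_upper, eventually_ge_atTop 3] with r hf hf' hr
    have h_pos : (0 : ℝ) < r := by exact_mod_cast (show 0 < r by omega)
    have h_log_pos : 0 < Real.log r := one_pos.trans_le (one_le_log hr)
    rw [div_add_one h_log_pos.ne', ← add_div]
    gcongr
    calc Real.log (f r) ≤ Real.log (C * (r * Real.log r)) :=
          Real.log_le_log (h_pos.trans_le hf) hf'
      _ = Real.log C + Real.log r + Real.log (Real.log r) := by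
          rw [Real.log_mul hC.ne' (by positivity), Real.log_mul h_pos.ne' h_log_pos.ne', add_assoc]

end PlanarTree

theorem mainTheorem12 (μ : ℝ) (hμ : μ < 0) :
    ∃ ν : MeasureTheory.Measure PlanarTree, PlanarTree.IsLocalLimit μ ν ∧
      (∃ C₁ C₂ : ℝ, 0 < C₁ ∧ 0 < C₂ ∧
        ∀ᵐ T ∂ν, ∃ r₀ : ℕ, ∀ r : ℕ, r₀ ≤ r →
          (1 ≤ T.width r ∧ (T.width r : ℝ) ≤ C₁ * Real.log r) ∧
          (r ≤ T.ballVolume r ∧ (T.ballVolume r : ℝ) ≤ C₂ * (r * Real.log r))) ∧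
      ∀ᵐ T ∂ν, T.HasHausdorffDim 1 := by
  have hb := Real.exp_pos μ
  obtain ⟨C, hC, h_width⟩ := PlanarTree.ae_eventually_width_le hb (Real.exp_lt_one_iff.2 hμ)
  have h_growth : ∀ᵐ T ∂PlanarTree.limitMeasure (Real.exp μ), ∃ r₀ : ℕ, ∀ r : ℕ, r₀ ≤ r →
      (1 ≤ T.width r ∧ (T.width r : ℝ) ≤ C * Real.log r) ∧
      (r ≤ T.ballVolume r ∧ (T.ballVolume r : ℝ) ≤ (C + 1) * (r * Real.log r)) := by
    filter_upwards [PlanarTree.ae_width_ne_zero hb, h_width] with T h_ne h_le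
    exact PlanarTree.exists_growth_bounds h_ne hC.le h_le
  refine ⟨_, PlanarTree.isLocalLimit_limitMeasure hμ,
    ⟨C, C + 1, hC, by linarith, h_growth⟩, ?_⟩
  filter_upwards [h_growth] with T ⟨r₀, h⟩
  have h_large := eventually_ge_atTop r₀
  exact PlanarTree.tendsto_log_div_log_of_le (by linarith : 0 < C + 1)
    (h_large.mono fun r hr => by exact_mod_cast (h r hr).2.1)
    (h_large.mono fun r hr => (h r hr).2.2)
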